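/- Call a bounded nondegenerate interval $I\subset\mathbb R$ one-sided if $I\subset(-\infty,0]$ or $I\subset[0,\infty)$. A two-sided atom is an integrable function $a$ for which there is a one-sided interval $I$ such that $a$ vanishes outside $I$, $|a|\le 1/|I|$ a.e., and $\int_I a\,dx=0$. The two-sided Hardy space $H^1_{2s}$ consists of all $f\in L^1(\mathbb R)$ of the form $f=\sum_{j}\lambda_j a_j$, with convergence in $L^1$, two-sided atoms $a_j$ and scalars $\lambda_j$ with $\sum_j|\lambda_j|<\infty$; it is normed by $\|f\|_{H^1_{2s}}=\inf\sum_j|\lambda_j|$, the infimum being taken over all such representations of $f$. The space $\mathrm{BMO}_{2s}$ consists of all locally integrable functions $\varphi$ on $\mathbb R$ with $$\|\varphi\|_{*,2s}=\sup_{I\text{ one-sided}}\frac1{|I|}\int_I|\varphi-\varphi_I|\,dx<\infty,\qquad \varphi_I=\frac1{|I|}\int_I\varphi\,dx .$$ Functions and scalars may be real throughout or complex throughout. **Theorem.** $\mathrm{BMO}_{2s}$, modulo two constants (one for each side of the origin), is the dual of $H^1_{2s}$. More precisely, there is a constant $c>0$ such that the following holds. 1. For every $\varphi\in\mathrm{BMO}_{2s}$,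 the integral $L_\varphi(f)=\int_{\mathbb R}f\varphi\,dx$ converges absolutely for all bounded compactly supported $f\in H^1_{2s}$, and the functional $L_\varphi$ so defined has a unique extension to a bounded linear functional on $H^1_{2s}$; the norm of this extension is at most $c\,\|\varphi\|_{*,2s}$. 2. For every bounded linear functional $L$ on $H^1_{2s}$ there is $\varphi\in\mathrm{BMO}_{2s}$ with $c^{-1}\|L\|\le\|\varphi\|_{*,2s}\le c\,\|L\|$ such that $L(f)=\int_{\mathbb R}f\varphi\,dx$ for every bounded compactly supported $f\in H^1_{2s}$. A function $\psi\in\mathrm{BMO}_{2s}$ represents the same $L$ in this way if and only if $\varphi-\psi$ is a.e. equal to a constant on $(-\infty,0)$ and a.e. equal to a constant on $(0,\infty)$. -/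

import Mathlib

open MeasureTheory Set
open scoped ENNReal

noncomputable section

namespace TwoSided

/-- The endpoints `α < β` of a bounded nondegenerate interval that lies on one side of the
origin (the origin may be an endpoint). -/
def OneSided (α β : ℝ) : Prop := α < β ∧ (β ≤ 0 ∨ 0 ≤ α)

/-- Two-sided `L^∞` atoms, as elements of `L¹(ℝ)`: supported in a bounded interval on one side of
the origin, bounded by the reciprocal of its length, with vanishing integral. -/
def IsAtom {𝕜 : Type*} [RCLike 𝕜] (a : Lp 𝕜 1 (volume : Measure ℝ)) : Prop :=
  ∃ α β : ℝ, OneSided α β ∧ (∀ᵐ x, x ∉ Icc α β → a x = 0) ∧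
    (∀ᵐ x, ‖a x‖ ≤ 1 / (β - α)) ∧ ∫ x in Icc α β, a x = 0

/-- `f = ∑ lam j • a j` in `L¹(ℝ)`, with two-sided atoms `a j` and `∑ |lam j| < ∞`. -/
def IsAtomicDecomp {𝕜 : Type*} [RCLike 𝕜] (lam : ℕ → 𝕜) (a : ℕ → Lp 𝕜 1 (volume : Measure ℝ))
    (f : Lp 𝕜 1 (volume : Measure ℝ)) : Prop :=
  (∀ j, IsAtom (a j)) ∧ Summable (fun j => ‖lam j‖) ∧ HasSum (fun j => lam j • a j) f

/-- The atomic norm. -/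
def atomicNorm {𝕜 : Type*} [RCLike 𝕜] (f : Lp 𝕜 1 (volume : Measure ℝ)) : ℝ :=
  sInf {r : ℝ | ∃ lam a, IsAtomicDecomp lam a f ∧ r = ∑' j, ‖lam j‖}

section Lemmas

variable {𝕜 : Type*} [RCLike 𝕜]

theorem isAtom_zero : IsAtom (0 : Lp 𝕜 1 (volume : Measure ℝ)) := by
  have h0 := Lp.coeFn_zero 𝕜 1 (volume : Measure ℝ)
  refine ⟨0, 1, ⟨by norm_num, Or.inr le_rfl⟩, ?_, ?_, ?_⟩
  · filter_upwards [h0] with x hx _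
    simp
  · filter_upwards [h0] with x hx
    rw [hx]
    simp
  · rw [integral_congr_ae (ae_restrict_of_ae h0)]
    simp

theorem IsAtom.norm_le_one {a : Lp 𝕜 1 (volume : Measure ℝ)} (ha : IsAtom a) : ‖a‖ ≤ 1 := by
  obtain ⟨α, β, ⟨hαβ, -⟩, hs, hb, -⟩ := ha
  rw [L1.norm_eq_integral_norm]
  have hpos : 0 < β - α := sub_pos.2 hαβ
  calc ∫ x, ‖a x‖ ≤ ∫ x, (Icc α β).indicator (fun _ => 1 / (β - α)) x := by
        refine integral_mono_ae (L1.integrable_coeFn a).norm ?_ ?_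
        · exact (integrable_const_on α β (1 / (β - α)))
        · filter_upwards [hs, hb] with x h1 h2
          by_cases hx : x ∈ Icc α β
          · simpa [hx] using h2
          · simp [hx, h1 hx]
    _ = 1 := by
        rw [integral_indicator measurableSet_Icc]
        simp only [integral_const, smul_eq_mul]
        simp [hαβ.le]
        field_simp
where
  integrable_const_on (α β c : ℝ) :
      Integrable ((Icc α β).indicator (fun _ => c)) (volume : Measure ℝ) :=
    (integrable_indicator_iff measurableSet_Icc).2
      (integrableOn_const (by simp))

theorem IsAtomicDecomp.norm_le {lam : ℕ → 𝕜} {a : ℕ → Lp 𝕜 1 (volume : Measure ℝ)}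
    {f : Lp 𝕜 1 (volume : Measure ℝ)} (h : IsAtomicDecomp lam a f) : ‖f‖ ≤ ∑' j, ‖lam j‖ := by
  obtain ⟨ha, hl, hf⟩ := h
  rw [← hf.tsum_eq]
  refine tsum_of_norm_bounded hl.hasSum fun j => ?_
  rw [norm_smul]
  exact mul_le_of_le_one_right (norm_nonneg _) (ha j).norm_le_one

theorem isAtomicDecomp_zero :
    IsAtomicDecomp (fun _ => (0 : 𝕜)) (fun _ => 0) (0 : Lp 𝕜 1 (volume : Measure ℝ)) :=
  ⟨fun _ => isAtom_zero, by simp, by simp⟩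

theorem IsAtomicDecomp.smul {lam : ℕ → 𝕜} {a : ℕ → Lp 𝕜 1 (volume : Measure ℝ)}
    {f : Lp 𝕜 1 (volume : Measure ℝ)} (h : IsAtomicDecomp lam a f) (c : 𝕜) :
    IsAtomicDecomp (fun j => c * lam j) a (c • f) := by
  obtain ⟨ha, hl, hf⟩ := h
  refine ⟨ha, by simpa using hl.mul_left ‖c‖, ?_⟩
  simpa [mul_smul] using hf.const_smul c

theorem exists_interleave {E : Type*} [NormedAddCommGroup E] [NormedSpace 𝕜 E] (P : E → Prop)
    {lam mu : ℕ → 𝕜} {a b : ℕ → E} {f g : E} {s t : ℝ}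
    (ha : ∀ j, P (a j)) (hb : ∀ j, P (b j))
    (hl : HasSum (fun j => ‖lam j‖) s) (hm : HasSum (fun j => ‖mu j‖) t)
    (hf : HasSum (fun j => lam j • a j) f) (hg : HasSum (fun j => mu j • b j) g) :
    ∃ (nu : ℕ → 𝕜) (d : ℕ → E), (∀ j, P (d j)) ∧ HasSum (fun j => ‖nu j‖) (s + t) ∧
      HasSum (fun j => nu j • d j) (f + g) := by
  obtain ⟨e⟩ : Nonempty (ℕ ≃ ℕ ⊕ ℕ) := ⟨Equiv.natSumNatEquivNat.symm⟩
  have key : HasSum (fun i : ℕ ⊕ ℕ => ‖Sum.elim lam mu i‖) (s + t) :=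
    HasSum.sum (f := fun i : ℕ ⊕ ℕ => ‖Sum.elim lam mu i‖) hl hm
  have key2 : HasSum (fun i : ℕ ⊕ ℕ => Sum.elim lam mu i • Sum.elim a b i) (f + g) :=
    HasSum.sum (f := fun i : ℕ ⊕ ℕ => Sum.elim lam mu i • Sum.elim a b i) hf hg
  refine ⟨Sum.elim lam mu ∘ e, Sum.elim a b ∘ e, fun j => ?_,
    e.hasSum_iff.2 key, e.hasSum_iff.2 key2⟩
  have hP : ∀ i, P (Sum.elim a b i) := by
    rintro (i | i)
    · exact ha i
    · exact hb i
  exact hP (e j)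

theorem IsAtomicDecomp.exists_add {lam mu : ℕ → 𝕜} {a b : ℕ → Lp 𝕜 1 (volume : Measure ℝ)}
    {f g : Lp 𝕜 1 (volume : Measure ℝ)} (h : IsAtomicDecomp lam a f)
    (h' : IsAtomicDecomp mu b g) :
    ∃ nu d, IsAtomicDecomp nu d (f + g) ∧ ∑' j, ‖nu j‖ = ∑' j, ‖lam j‖ + ∑' j, ‖mu j‖ := by
  obtain ⟨nu, d, h1, h2, h3⟩ := exists_interleave IsAtom h.1 h'.1 h.2.1.hasSum h'.2.1.hasSum
    h.2.2 h'.2.2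
  exact ⟨nu, d, ⟨h1, h2.summable, h3⟩, h2.tsum_eq⟩

theorem atomicNorm_le {lam : ℕ → 𝕜} {a : ℕ → Lp 𝕜 1 (volume : Measure ℝ)}
    {f : Lp 𝕜 1 (volume : Measure ℝ)} (h : IsAtomicDecomp lam a f) :
    atomicNorm f ≤ ∑' j, ‖lam j‖ :=
  csInf_le ⟨0, by rintro r ⟨l, _, _, rfl⟩; exact tsum_nonneg fun _ => norm_nonneg _⟩
    ⟨lam, a, h, rfl⟩

theorem le_atomicNorm {f : Lp 𝕜 1 (volume : Measure ℝ)} {c : ℝ}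
    (hf : ∃ lam a, IsAtomicDecomp lam a f)
    (h : ∀ lam a, IsAtomicDecomp lam a f → c ≤ ∑' j, ‖lam j‖) : c ≤ atomicNorm f := by
  obtain ⟨lam, a, hla⟩ := hf
  refine le_csInf ⟨_, lam, a, hla, rfl⟩ ?_
  rintro r ⟨l, b, hb, rfl⟩
  exact h l b hb

end Lemmas

/-- The integrable functions that have a two-sided atomic decomposition. -/
def H1Submodule (𝕜 : Type*) [RCLike 𝕜] : Submodule 𝕜 (Lp 𝕜 1 (volume : Measure ℝ)) where
  carrier := {f | ∃ lam a, IsAtomicDecomp lam a f}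
  zero_mem' := ⟨_, _, isAtomicDecomp_zero⟩
  add_mem' := by
    rintro f g ⟨_, _, hf⟩ ⟨_, _, hg⟩
    obtain ⟨nu, d, h, -⟩ := hf.exists_add hg
    exact ⟨nu, d, h⟩
  smul_mem' := by
    rintro c f ⟨_, _, hf⟩
    exact ⟨_, _, hf.smul c⟩

/-- The two-sided Hardy space. It carries the atomic norm, not the norm of `L¹`. -/
def H1 (𝕜 : Type*) [RCLike 𝕜] : Type _ := H1Submodule 𝕜

namespace H1

variable {𝕜 : Type*} [RCLike 𝕜]

instance : AddCommGroup (H1 𝕜) := inferInstanceAs (AddCommGroup (H1Submodule 𝕜))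

instance : Module 𝕜 (H1 𝕜) := inferInstanceAs (Module 𝕜 (H1Submodule 𝕜))

/-- The inclusion of the two-sided Hardy space in `L¹(ℝ)`. -/
def toL1 : H1 𝕜 →ₗ[𝕜] Lp 𝕜 1 (volume : Measure ℝ) := (H1Submodule 𝕜).subtype

theorem toL1_injective : Function.Injective (toL1 (𝕜 := 𝕜)) := Subtype.val_injective

theorem exists_decomp (f : H1 𝕜) : ∃ lam a, IsAtomicDecomp lam a f.toL1 := f.2

instance : Norm (H1 𝕜) := ⟨fun f => atomicNorm f.toL1⟩

theorem norm_def (f : H1 𝕜) : ‖f‖ = atomicNorm f.toL1 := rfl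

theorem norm_toL1_le (f : H1 𝕜) : ‖f.toL1‖ ≤ ‖f‖ :=
  le_atomicNorm f.exists_decomp fun _ _ h => h.norm_le

theorem norm_smul_le' (c : 𝕜) (f : H1 𝕜) : ‖c • f‖ ≤ ‖c‖ * ‖f‖ := by
  rcases eq_or_ne c 0 with rfl | hc
  · rw [norm_def, zero_smul, map_zero]
    simpa using atomicNorm_le (isAtomicDecomp_zero (𝕜 := 𝕜))
  · have hc' : 0 < ‖c‖ := norm_pos_iff.2 hc
    rw [← div_le_iff₀' hc']
    refine le_atomicNorm f.exists_decomp fun lam a h => ?_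
    rw [div_le_iff₀' hc', ← tsum_mul_left]
    have := atomicNorm_le (h.smul c)
    simp only [norm_mul] at this
    rwa [norm_def, map_smul]

theorem core : NormedSpace.Core 𝕜 (H1 𝕜) where
  norm_nonneg f := (norm_nonneg _).trans f.norm_toL1_le
  norm_smul c f := by
    refine le_antisymm (norm_smul_le' c f) ?_
    rcases eq_or_ne c 0 with rfl | hc
    · simpa using (norm_nonneg _).trans (norm_toL1_le ((0 : 𝕜) • f))
    · have h := norm_smul_le' c⁻¹ (c • f)
      rw [inv_smul_smul₀ hc, norm_inv] at h
      rwa [← le_inv_mul_iff₀ (norm_pos_iff.2 hc)]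
  norm_triangle f g := by
    rw [← sub_le_iff_le_add]
    refine le_atomicNorm f.exists_decomp fun lam a h => ?_
    rw [sub_le_comm]
    refine le_atomicNorm g.exists_decomp fun mu b h' => ?_
    obtain ⟨nu, d, hd, hs⟩ := h.exists_add h'
    have := atomicNorm_le hd
    rw [hs] at this
    rw [sub_le_iff_le_add']
    exact this
  norm_eq_zero_iff f := by
    constructor
    · intro h
      have h1 := f.norm_toL1_le
      rw [h] at h1
      exact toL1_injective (by simpa using norm_le_zero_iff.1 h1)
    · rintro rfl
      refine le_antisymm ?_ ((norm_nonneg _).trans (norm_toL1_le (0 : H1 𝕜)))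
      simpa using norm_smul_le' (0 : 𝕜) (0 : H1 𝕜)

instance : NormedAddCommGroup (H1 𝕜) := NormedAddCommGroup.ofCore core

instance : NormedSpace 𝕜 (H1 𝕜) := NormedSpace.ofCore core

/-- `f` is (a.e. equal to) a bounded function with compact support. -/
def BoundedCompactSupport (f : H1 𝕜) : Prop :=
  ∃ M R : ℝ, (∀ᵐ x, ‖f.toL1 x‖ ≤ M) ∧ (∀ᵐ x, R < |x| → f.toL1 x = 0)

end H1

/-- The two-sided mean oscillation `‖φ‖_{*,2s}`, with values in `[0, ∞]`. -/
def bmoENorm {𝕜 : Type*} [RCLike 𝕜] (φ : ℝ → 𝕜) : ℝ≥0∞ :=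
  ⨆ (α : ℝ) (β : ℝ) (_ : OneSided α β),
    (ENNReal.ofReal (β - α))⁻¹ * ∫⁻ x in Icc α β, ‖φ x - ⨍ y in Icc α β, φ y‖ₑ

/-- Membership in two-sided BMO. -/
def MemBMO {𝕜 : Type*} [RCLike 𝕜] (φ : ℝ → 𝕜) : Prop :=
  LocallyIntegrable φ ∧ bmoENorm φ < ∞

/-- `‖φ‖_{*,2s}` as a real number, for `φ` in two-sided BMO. -/
def bmoNorm {𝕜 : Type*} [RCLike 𝕜] (φ : ℝ → 𝕜) : ℝ := (bmoENorm φ).toReal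

/-- The functional `L` is given by integration against `φ` on the bounded compactly supported
functions of the two-sided Hardy space. -/
def Represents {𝕜 : Type*} [RCLike 𝕜] (φ : ℝ → 𝕜) (L : H1 𝕜 →L[𝕜] 𝕜) : Prop :=
  ∀ f : H1 𝕜, f.BoundedCompactSupport →
    Integrable (fun x => f.toL1 x * φ x) ∧ L f = ∫ x, f.toL1 x * φ x

/-- Equality a.e. modulo two constants, one for each side of the origin. -/
def EqModConsts {𝕜 : Type*} [RCLike 𝕜] (φ ψ : ℝ → 𝕜) : Prop :=
  ∃ d e : 𝕜, ∀ᵐ x : ℝ, φ x - ψ x = if x < 0 then d else e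

end TwoSided

end

/-! A function `φ` of bounded oscillation pairs with an atom through `φ - φ_I`, which gives the
bound on atoms. An atomic series converges only in `L¹`, so it cannot be integrated termwise against
an unbounded `φ`. The truncations of `φ` are bounded, hence continuous on `L¹`, and their
oscillation is at most twice that of `φ`. The bound on atoms therefore passes to the whole Hardy
space, and dominated convergence removes the truncation for bounded compactly supported `f`
(`H1.norm_integral_mul_le`). Such `f` are dense, so the functional extends uniquely.

Conversely, let `L` be bounded on the Hardy space. Atoms are bounded functions and the dual of `L^∞`
is too large, so some countable additivity has to be found. It comes from a Calderón–Zygmund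
decomposition (`H1.exists_of_bounded`): a mean-zero function bounded by `M` on an interval with
integer endpoints has atomic norm at most `(2M/t) ‖h‖₁ + 2t (q - p)`, so for fixed `M` it is small
once `‖h‖₁` is small. The argument works here because dyadic intervals of length at most one never
straddle the origin.

Consequently, on each unit cell, `E ↦ L(1_E - |E| 1_S)` is an absolutely continuous measure, where
`S` is the unit interval next to the origin on the same side. Radon–Nikodym gives a density. As `S`
is common to all cells of a side, the corrections cancel when a mean-zero function is cut into
cells, and the densities glue to one `φ` (`exists_locallyIntegrable_density`). Testing against the
phase of `φ - φ_I` bounds the oscillation. The same test shows that a function annihilating all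
atoms is constant on each side. -/

namespace TwoSided

variable {𝕜 : Type*} [RCLike 𝕜]

/-! ### Blocks: scalar multiples of atoms -/

/-- A multiple `s` of a two-sided atom, as a function. -/
def IsBlock (b : ℝ → 𝕜) (s : ℝ) : Prop :=
  AEStronglyMeasurable b ∧ ∃ α β : ℝ, OneSided α β ∧ (∀ᵐ x, x ∉ Icc α β → b x = 0) ∧
    (∀ᵐ x, ‖b x‖ ≤ s / (β - α)) ∧ ∫ x, b x = 0

theorem integrable_of_bounded_of_support {b : ℝ → 𝕜} (hm : AEStronglyMeasurable b) {α β M : ℝ}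
    (hs : ∀ᵐ x, x ∉ Icc α β → b x = 0) (hb : ∀ᵐ x, ‖b x‖ ≤ M) : Integrable b := by
  have h1 : Integrable ((Icc α β).indicator (fun _ => M)) :=
    (integrable_indicator_iff measurableSet_Icc).2 (integrableOn_const (by simp))
  refine h1.mono' hm ?_
  filter_upwards [hs, hb] with x h1 h2
  by_cases hx : x ∈ Icc α β
  · simpa [hx] using h2
  · simp [hx, h1 hx]

theorem IsBlock.integrable {b : ℝ → 𝕜} {s : ℝ} (h : IsBlock b s) : Integrable b := by
  obtain ⟨hm, α, β, -, hs, hb, -⟩ := h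
  exact integrable_of_bounded_of_support hm hs hb

theorem IsBlock.nonneg {b : ℝ → 𝕜} {s : ℝ} (h : IsBlock b s) : 0 ≤ s := by
  obtain ⟨-, α, β, ho, -, hb, -⟩ := h
  obtain ⟨x, hx⟩ := hb.exists
  have := (norm_nonneg _).trans hx
  by_contra hc
  exact absurd this (not_le.2 (div_neg_of_neg_of_pos (not_le.1 hc) (sub_pos.2 ho.1)))

theorem isBlock_zero : IsBlock (fun _ => (0 : 𝕜)) 0 :=
  ⟨aestronglyMeasurable_const, 0, 1, ⟨by norm_num, Or.inr le_rfl⟩, by simp, by simp, by simp⟩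

theorem IsBlock.exists_atom {b : ℝ → 𝕜} {s : ℝ} (h : IsBlock b s) :
    ∃ a : Lp 𝕜 1 (volume : Measure ℝ), IsAtom a ∧ (s : 𝕜) • a = h.integrable.toL1 b := by
  have hs0 := h.nonneg
  obtain ⟨hm, α, β, ho, hs, hb, hi⟩ := id h
  have hpos : 0 < β - α := sub_pos.2 ho.1
  have hc := (h.integrable).coeFn_toL1
  have hsm := Lp.coeFn_smul ((s : 𝕜)⁻¹) (h.integrable.toL1 b)
  refine ⟨(s : 𝕜)⁻¹ • h.integrable.toL1 b, ⟨α, β, ho, ?_, ?_, ?_⟩, ?_⟩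
  · filter_upwards [hc, hsm, hs] with x h1 h2 h3 hx
    rw [h2, Pi.smul_apply, h1, h3 hx, smul_zero]
  · filter_upwards [hc, hsm, hb] with x h1 h2 h3
    rw [h2, Pi.smul_apply, h1, norm_smul, norm_inv, RCLike.norm_ofReal, abs_of_nonneg hs0]
    calc s⁻¹ * ‖b x‖ ≤ s⁻¹ * (s / (β - α)) := by gcongr
      _ = (s⁻¹ * s) / (β - α) := by ring
      _ ≤ 1 / (β - α) := by
        gcongr
        exact inv_mul_le_one
  · have : ∀ᵐ x, ((s : 𝕜)⁻¹ • h.integrable.toL1 b : Lp 𝕜 1 (volume : Measure ℝ)) x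
        = (s : 𝕜)⁻¹ * b x := by
      filter_upwards [hc, hsm] with x h1 h2
      rw [h2, Pi.smul_apply, h1, smul_eq_mul]
    rw [setIntegral_eq_integral_of_ae_compl_eq_zero, integral_congr_ae this,
      integral_const_mul, hi, mul_zero]
    filter_upwards [this, hs] with x h1 h2 hx
    rw [h1, h2 hx, mul_zero]
  -- For `s = 0` the inverse is `0` by convention, so the atom is zero; `b` vanishes a.e. because
  -- its bound is `0`.
  · rcases eq_or_ne s 0 with rfl | hne
    · simp only [RCLike.ofReal_zero, zero_smul]
      symm
      rw [Lp.eq_zero_iff_ae_eq_zero]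
      filter_upwards [hc, hb] with x h1 h2
      rw [h1]
      simpa using h2
    · rw [smul_inv_smul₀]
      exact_mod_cast hne

/-! ### Elements of the Hardy space and sums of blocks -/

theorem H1.ext_ae {f g : H1 𝕜} (h : f.toL1 =ᵐ[volume] g.toL1) : f = g :=
  H1.toL1_injective (Lp.ext h)

theorem H1.integrable (f : H1 𝕜) : Integrable f.toL1 := L1.integrable_coeFn _

theorem H1.coeFn_add (f g : H1 𝕜) : (f + g).toL1 =ᵐ[volume] fun x => f.toL1 x + g.toL1 x := by
  rw [map_add]; exact Lp.coeFn_add _ _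

theorem H1.coeFn_smul (c : 𝕜) (f : H1 𝕜) : (c • f).toL1 =ᵐ[volume] fun x => c * f.toL1 x := by
  rw [map_smul]; exact Lp.coeFn_smul _ _

theorem H1.exists_of_decomp {lam : ℕ → 𝕜} {a : ℕ → Lp 𝕜 1 (volume : Measure ℝ)}
    {f : Lp 𝕜 1 (volume : Measure ℝ)} (h : IsAtomicDecomp lam a f) :
    ∃ g : H1 𝕜, g.toL1 = f ∧ ‖g‖ ≤ ∑' j, ‖lam j‖ := by
  refine ⟨⟨f, lam, a, h⟩, rfl, ?_⟩
  exact atomicNorm_le h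

/-- Dominated convergence along the finite subsets of `ι`, whose `atTop` filter is countably
generated because `ι` is countable. -/
theorem hasSum_toL1_of_dominated {ι : Type*} [Countable ι] {b : ι → ℝ → 𝕜}
    (hb : ∀ j, Integrable (b j)) {B : ℝ → 𝕜} {G : ℝ → ℝ} (hG : Integrable G)
    (hdom : ∀ F : Finset ι, ∀ᵐ x, ‖∑ j ∈ F, b j x - B x‖ ≤ G x) (hBi : Integrable B)
    (hB : ∀ᵐ x, HasSum (fun j => b j x) (B x)) :
    HasSum (fun j => (hb j).toL1 (b j)) (hBi.toL1 B) := by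
  rw [HasSum]
  rw [tendsto_iff_norm_sub_tendsto_zero]
  have key : Filter.Tendsto (fun F : Finset ι => ∫ x, ‖∑ j ∈ F, b j x - B x‖) Filter.atTop
      (nhds (∫ _ : ℝ, (0 : ℝ))) := by
    refine tendsto_integral_filter_of_dominated_convergence G ?_ ?_ hG ?_
    · refine Filter.Eventually.of_forall fun F => ?_
      exact ((Finset.aestronglyMeasurable_fun_sum F fun j _ => (hb j).1).sub hBi.1).norm
    · refine Filter.Eventually.of_forall fun F => ?_
      filter_upwards [hdom F] with x hx
      simpa using hx
    · filter_upwards [hB] with x hx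
      exact tendsto_iff_norm_sub_tendsto_zero.1 hx
  simp only [integral_zero] at key
  refine key.congr fun F => ?_
  have hFi : Integrable (fun x => ∑ j ∈ F, b j x) :=
    integrable_finsetSum F fun j _ => (hb j)
  have e1 : ∑ j ∈ F, (hb j).toL1 (b j) = hFi.toL1 _ := by
    classical
    clear key
    induction F using Finset.induction_on with
    | empty =>
      simp only [Finset.sum_empty]
      exact (Integrable.toL1_zero _).symm
    | insert i F hi ih =>
      have hF' : Integrable (fun x => ∑ j ∈ F, b j x) :=
        integrable_finsetSum F fun j _ => (hb j)
      rw [Finset.sum_insert hi, ih hF', ← Integrable.toL1_add]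
      congr 1
      ext x
      simp [Finset.sum_insert hi]
  rw [e1, ← Integrable.toL1_sub, L1.norm_eq_integral_norm]
  refine integral_congr_ae ?_
  filter_upwards [(hFi.sub hBi).coeFn_toL1] with x hx
  rw [hx]; rfl

/-- A sum of blocks with summable constants belongs to the Hardy space. -/
theorem H1.exists_of_hasSum_blocks {ι : Type*} [Denumerable ι] {b : ι → ℝ → 𝕜} {s : ι → ℝ}
    (hb : ∀ j, IsBlock (b j) (s j)) (hs : Summable s) {B : ℝ → 𝕜} {G : ℝ → ℝ} (hG : Integrable G)
    (hdom : ∀ F : Finset ι, ∀ᵐ x, ‖∑ j ∈ F, b j x - B x‖ ≤ G x) (hBi : Integrable B)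
    (hB : ∀ᵐ x, HasSum (fun j => b j x) (B x)) :
    ∃ f : H1 𝕜, f.toL1 =ᵐ[volume] B ∧ ‖f‖ ≤ ∑' j, s j := by
  choose a ha hab using fun j => (hb j).exists_atom
  have hsum : HasSum (fun j => (s j : 𝕜) • a j) (hBi.toL1 B) := by
    simp only [hab]
    exact hasSum_toL1_of_dominated (fun j => (hb j).integrable) hG hdom hBi hB
  obtain ⟨e⟩ : Nonempty (ℕ ≃ ι) := ⟨(Denumerable.eqv ι).symm⟩
  have hn : ∀ j, ‖((s j : ℝ) : 𝕜)‖ = s j := by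
    intro j
    rw [RCLike.norm_ofReal, abs_of_nonneg (hb j).nonneg]
  have hD : IsAtomicDecomp (fun n => (s (e n) : 𝕜)) (fun n => a (e n)) (hBi.toL1 B) :=
    ⟨fun n => ha _, by simpa only [hn, Function.comp_def] using (e.summable_iff (f := s)).2 hs,
      e.hasSum_iff.2 hsum⟩
  obtain ⟨f, hf, hle⟩ := H1.exists_of_decomp hD
  refine ⟨f, ?_, ?_⟩
  · rw [hf]; exact hBi.coeFn_toL1
  · refine hle.trans_eq ?_
    rw [← e.tsum_eq s]
    simp only [hn]

theorem IsBlock.exists_h1 {b : ℝ → 𝕜} {s : ℝ} (h : IsBlock b s) :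
    ∃ f : H1 𝕜, f.toL1 =ᵐ[volume] b ∧ ‖f‖ ≤ s := by
  obtain ⟨a, ha, hab⟩ := h.exists_atom
  have hz : ∀ j : ℕ, j ≠ 0 → ‖(if j = 0 then (s : 𝕜) else 0)‖ = 0 := fun j hj => by simp [hj]
  have hD : IsAtomicDecomp (fun n : ℕ => if n = 0 then (s : 𝕜) else 0) (fun _ => a)
      (h.integrable.toL1 b) := by
    refine ⟨fun _ => ha, (hasSum_single 0 hz).summable, ?_⟩
    have := hasSum_single (f := fun n : ℕ => (if n = 0 then (s : 𝕜) else 0) • a) 0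
      (fun j hj => by simp [hj])
    simpa [hab] using this
  obtain ⟨f, hf, hle⟩ := H1.exists_of_decomp hD
  refine ⟨f, hf ▸ h.integrable.coeFn_toL1, hle.trans_eq ?_⟩
  rw [(hasSum_single 0 hz).tsum_eq]
  simp [abs_of_nonneg h.nonneg]

/-! ### Functionals continuous on `L¹` -/

/-- Integration against a bounded function is continuous on `L¹`. -/
theorem exists_clm_of_bounded {φ : ℝ → 𝕜} (hm : AEStronglyMeasurable φ) {K : ℝ}
    (hK : ∀ x, ‖φ x‖ ≤ K) :
    ∃ Λ : Lp 𝕜 1 (volume : Measure ℝ) →L[𝕜] 𝕜, ∀ f, Λ f = ∫ x, f x * φ x := by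
  have hi : ∀ f : Lp 𝕜 1 (volume : Measure ℝ), Integrable (fun x => f x * φ x) := fun f =>
    (L1.integrable_coeFn f).mul_bdd (c := K) hm (Filter.Eventually.of_forall hK)
  refine ⟨LinearMap.mkContinuous
    { toFun := fun f => ∫ x, f x * φ x
      map_add' := fun f g => ?_
      map_smul' := fun c f => ?_ } K fun f => ?_, fun f => rfl⟩
  · rw [← integral_add (hi f) (hi g)]
    refine integral_congr_ae ?_
    filter_upwards [Lp.coeFn_add f g] with x hx
    rw [hx, Pi.add_apply, add_mul]
  · rw [RingHom.id_apply, smul_eq_mul, ← integral_const_mul]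
    refine integral_congr_ae ?_
    filter_upwards [Lp.coeFn_smul c f] with x hx
    rw [hx, Pi.smul_apply, smul_eq_mul, mul_assoc]
  · change ‖∫ x, f x * φ x‖ ≤ _
    rw [L1.norm_eq_integral_norm, ← integral_const_mul]
    refine norm_integral_le_of_norm_le ((L1.integrable_coeFn f).norm.const_mul K) ?_
    filter_upwards with x
    rw [norm_mul, mul_comm]
    gcongr
    exact hK x

theorem IsAtom.isBlock {a : Lp 𝕜 1 (volume : Measure ℝ)} (ha : IsAtom a) :
    IsBlock (a : ℝ → 𝕜) 1 := by
  obtain ⟨α, β, ho, hs, hb, hi⟩ := ha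
  refine ⟨(L1.integrable_coeFn a).1, α, β, ho, hs, hb, ?_⟩
  rwa [setIntegral_eq_integral_of_ae_compl_eq_zero hs] at hi

/-- A functional on `L¹` with a bound on atoms obeys the same bound on the Hardy space. -/
theorem H1.norm_clm_le {Λ : Lp 𝕜 1 (volume : Measure ℝ) →L[𝕜] 𝕜} {A : ℝ}
    (hΛ : ∀ a, IsAtom a → ‖Λ a‖ ≤ A) (f : H1 𝕜) : ‖Λ f.toL1‖ ≤ A * ‖f‖ := by
  have hA : 0 ≤ A := (norm_nonneg _).trans (hΛ 0 isAtom_zero)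
  have key : ∀ lam a, IsAtomicDecomp lam a f.toL1 → ‖Λ f.toL1‖ ≤ A * ∑' j, ‖lam j‖ := by
    intro lam a h
    have h1 := h.2.2.mapL Λ
    rw [← h1.tsum_eq]
    refine tsum_of_norm_bounded (h.2.1.hasSum.mul_left A) fun j => ?_
    rw [map_smul, norm_smul, mul_comm]
    gcongr
    exact hΛ _ (h.1 j)
  -- Passing to the infimum divides by `A`. For `A = 0` a single decomposition suffices; this case
  -- shows that the one-sided integrals vanish.
  rcases hA.eq_or_lt with h0 | hpos
  · obtain ⟨lam, a, h⟩ := f.exists_decomp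
    simpa [← h0] using key lam a h
  · rw [← div_le_iff₀' hpos, H1.norm_def]
    refine le_atomicNorm f.exists_decomp fun lam a h => ?_
    rw [div_le_iff₀' hpos]
    exact key lam a h

/-- The elements of the Hardy space have integral zero over each side of the origin. -/
theorem H1.setIntegral_eq_zero (f : H1 𝕜) :
    ∫ x in Iio 0, f.toL1 x = 0 ∧ ∫ x in Ici 0, f.toL1 x = 0 := by
  have key : ∀ S : Set ℝ, MeasurableSet S →
      (∀ α β, OneSided α β → Icc α β ≤ᵐ[volume] S ∨ ∀ᵐ x, x ∈ Icc α β → x ∉ S) →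
      ∫ x in S, f.toL1 x = 0 := by
    intro S hS hS'
    obtain ⟨Λ, hΛ⟩ := exists_clm_of_bounded (𝕜 := 𝕜) (φ := S.indicator 1) (K := 1)
      ((stronglyMeasurable_const.indicator hS).aestronglyMeasurable) (by
        intro x
        by_cases hx : x ∈ S <;> simp [hx])
    have e : ∀ g : Lp 𝕜 1 (volume : Measure ℝ), Λ g = ∫ x in S, g x := by
      intro g
      rw [hΛ, ← integral_indicator hS]
      congr 1
      ext x
      by_cases hx : x ∈ S <;> simp [hx]
    have := H1.norm_clm_le (Λ := Λ) (A := 0) (fun a ha => ?_) f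
    · rw [e] at this
      simpa using this
    · rw [e]
      obtain ⟨α, β, ho, hs, hb, hi⟩ := ha
      rw [setIntegral_eq_integral_of_ae_compl_eq_zero hs] at hi
      rcases hS' α β ho with h | h
      · rw [setIntegral_eq_integral_of_ae_compl_eq_zero, hi, norm_zero]
        filter_upwards [hs, h] with x h1 h2 hx
        exact h1 fun hx' => hx (h2 hx')
      · rw [setIntegral_eq_zero_of_ae_eq_zero, norm_zero]
        filter_upwards [hs, h] with x h1 h2 hx
        exact h1 fun hx' => h2 hx' hx
  have hne : ∀ᵐ x : ℝ, x ≠ 0 := by simp [ae_iff]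
  constructor
  · refine key _ measurableSet_Iio fun α β ho => ?_
    rcases ho.2 with h | h
    · left
      filter_upwards [hne] with x hx hx'
      exact lt_of_le_of_ne (hx'.2.trans h) hx
    · right
      filter_upwards with x hx
      exact not_lt.2 (h.trans hx.1)
  · refine key _ measurableSet_Ici fun α β ho => ?_
    rcases ho.2 with h | h
    · right
      filter_upwards [hne] with x hx hx' hx''
      exact hx (le_antisymm (hx'.2.trans h) hx'')
    · left
      filter_upwards with x hx
      exact h.trans hx.1

/-! ### Density of the bounded compactly supported functions -/

namespace H1

/-- The bounded functions with compact support in the Hardy space. -/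
def bddSupport (𝕜 : Type*) [RCLike 𝕜] : Submodule 𝕜 (H1 𝕜) where
  carrier := {f | f.BoundedCompactSupport}
  zero_mem' := by
    refine ⟨0, 0, ?_, ?_⟩ <;> rw [map_zero] <;>
      filter_upwards [Lp.coeFn_zero 𝕜 1 (volume : Measure ℝ)] with x hx <;> simp
  add_mem' := by
    rintro f g ⟨M, R, h1, h2⟩ ⟨M', R', h1', h2'⟩
    refine ⟨M + M', max R R', ?_, ?_⟩
    · filter_upwards [h1, h1', coeFn_add f g] with x a b c
      rw [c]
      exact norm_add_le_of_le a b
    · filter_upwards [h2, h2', coeFn_add f g] with x a b c hx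
      rw [c, a ((le_max_left _ _).trans_lt hx), b ((le_max_right _ _).trans_lt hx), add_zero]
  smul_mem' := by
    rintro c f ⟨M, R, h1, h2⟩
    refine ⟨‖c‖ * M, R, ?_, ?_⟩
    · filter_upwards [h1, coeFn_smul c f] with x a b
      rw [b, norm_mul]
      gcongr
    · filter_upwards [h2, coeFn_smul c f] with x a b hx
      rw [b, a hx, mul_zero]

theorem boundedCompactSupport_of_isBlock {f : H1 𝕜} {b : ℝ → 𝕜} {s : ℝ} (hb : IsBlock b s)
    (hf : f.toL1 =ᵐ[volume] b) : f.BoundedCompactSupport := by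
  obtain ⟨-, α, β, ho, hs, hbd, -⟩ := hb
  refine ⟨s / (β - α), max |α| |β|, ?_, ?_⟩
  · filter_upwards [hf, hbd] with x h1 h2
    rwa [h1]
  · filter_upwards [hf, hs] with x h1 h2 hx
    rw [h1]
    refine h2 fun hx' => absurd hx (not_lt.2 (abs_le_max_abs_abs hx'.1 hx'.2))

/-- The partial sums of an atomic decomposition converge in the atomic norm: the shifted series
decomposes the remainder, so its norm is at most the tail of `∑ ‖lam j‖`. -/
theorem dense_bddSupport : Dense (bddSupport 𝕜 : Set (H1 𝕜)) := by
  intro f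
  obtain ⟨lam, a, h⟩ := f.exists_decomp
  choose g hg hgn using fun j => ((h.1 j).isBlock).exists_h1
  have hga : ∀ j, (g j).toL1 = a j := fun j => Lp.ext (hg j)
  have hgm : ∀ j, g j ∈ bddSupport 𝕜 := fun j =>
    boundedCompactSupport_of_isBlock (h.1 j).isBlock (hg j)
  refine mem_closure_of_tendsto (b := Filter.atTop)
    (f := fun n : ℕ => ∑ j ∈ Finset.range n, lam j • g j) ?_ (Filter.Eventually.of_forall fun n =>
      (bddSupport 𝕜).sum_mem fun j _ => (bddSupport 𝕜).smul_mem _ (hgm j))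
  rw [tendsto_iff_norm_sub_tendsto_zero]
  refine squeeze_zero (fun _ => norm_nonneg _) (fun n => ?_)
    (tendsto_sum_nat_add fun j => ‖lam j‖)
  rw [norm_sub_rev]
  have hD : IsAtomicDecomp (fun j => lam (j + n)) (fun j => a (j + n))
      (f - ∑ j ∈ Finset.range n, lam j • g j).toL1 := by
    refine ⟨fun j => h.1 _, (summable_nat_add_iff n).2 h.2.1, ?_⟩
    rw [map_sub, map_sum]
    simp only [map_smul, hga]
    exact (hasSum_nat_add_iff' n).2 h.2.2
  exact atomicNorm_le hD

end H1

/-! ### Pairing with functions of bounded mean oscillation -/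

theorem H1.BoundedCompactSupport.integrable_mul {f : H1 𝕜} (hf : f.BoundedCompactSupport)
    {φ : ℝ → 𝕜} (hφ : LocallyIntegrable φ) : Integrable (fun x => f.toL1 x * φ x) := by
  obtain ⟨M, R, h1, h2⟩ := hf
  have hi : IntegrableOn φ (Icc (-R) R) := hφ.integrableOn_isCompact isCompact_Icc
  have : IntegrableOn (fun x => f.toL1 x * φ x) (Icc (-R) R) :=
    hi.bdd_mul (c := M) f.integrable.1.restrict (ae_restrict_of_ae h1)
  refine this.integrable_of_ae_notMem_eq_zero ?_
  filter_upwards [h2] with x hx hx'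
  rw [hx (by rwa [← not_le, abs_le]), zero_mul]

theorem setIntegral_oscillation_le {φ : ℝ → 𝕜} (hφ : MemBMO φ) {α β : ℝ} (h : OneSided α β) :
    ∫ x in Icc α β, ‖φ x - ⨍ y in Icc α β, φ y‖ ≤ bmoNorm φ * (β - α) := by
  have hpos : 0 < β - α := sub_pos.2 h.1
  have h1 : (ENNReal.ofReal (β - α))⁻¹ * ∫⁻ x in Icc α β, ‖φ x - ⨍ y in Icc α β, φ y‖ₑ
      ≤ bmoENorm φ := le_iSup₂_of_le α β (le_iSup_of_le h le_rfl)
  have hint : IntegrableOn (fun x => φ x - ⨍ y in Icc α β, φ y) (Icc α β) :=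
    (hφ.1.integrableOn_isCompact isCompact_Icc).sub (integrableOn_const (by simp))
  rw [← ofReal_integral_norm_eq_lintegral_enorm hint] at h1
  have h2 := ENNReal.toReal_mono hφ.2.ne h1
  rw [ENNReal.toReal_mul, ENNReal.toReal_inv, ENNReal.toReal_ofReal hpos.le,
    ENNReal.toReal_ofReal (integral_nonneg fun _ => norm_nonneg _), inv_mul_le_iff₀ hpos] at h2
  rw [mul_comm]
  exact h2

/-- Since `b` has mean zero, any constant `z` may be subtracted from `φ`. The freedom in `z` allows
the truncated mean to be used in place of the mean of the truncation. -/
theorem IsBlock.norm_integral_mul_le {b φ : ℝ → 𝕜} {s A : ℝ} (hb : IsBlock b s)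
    (hφ : LocallyIntegrable φ)
    (hA : ∀ α β, OneSided α β → ∃ z : 𝕜, ∫ x in Icc α β, ‖φ x - z‖ ≤ A * (β - α)) :
    ‖∫ x, b x * φ x‖ ≤ A * s := by
  have hbi := hb.integrable
  have hs0 := hb.nonneg
  obtain ⟨hm, α, β, ho, hs, hbd, hi⟩ := hb
  obtain ⟨z, hz⟩ := hA α β ho
  have hpos : 0 < β - α := sub_pos.2 ho.1
  have hIφ : IntegrableOn φ (Icc α β) := hφ.integrableOn_isCompact isCompact_Icc
  have hIz : IntegrableOn (fun x => φ x - z) (Icc α β) := hIφ.sub (integrableOn_const (by simp))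
  have h1 : IntegrableOn (fun x => b x * (φ x - z)) (Icc α β) :=
    hIz.bdd_mul (c := s / (β - α)) hm.restrict (ae_restrict_of_ae hbd)
  have e1 : ∫ x, b x * φ x = ∫ x in Icc α β, b x * φ x := by
    rw [setIntegral_eq_integral_of_ae_compl_eq_zero]
    filter_upwards [hs] with x h hx
    rw [h hx, zero_mul]
  have e2 : ∫ x in Icc α β, b x = 0 := by
    rwa [setIntegral_eq_integral_of_ae_compl_eq_zero hs]
  have e3 : ∫ x in Icc α β, b x * φ x = ∫ x in Icc α β, b x * (φ x - z) := by
    have : ∫ x in Icc α β, b x * φ x = ∫ x in Icc α β, (b x * (φ x - z) + b x * z) := by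
      congr 1; ext x; ring
    rw [this, integral_add h1 (hbi.integrableOn.mul_const z), integral_mul_const, e2, zero_mul,
      add_zero]
  rw [e1, e3]
  calc ‖∫ x in Icc α β, b x * (φ x - z)‖ ≤ ∫ x in Icc α β, s / (β - α) * ‖φ x - z‖ := by
        refine norm_integral_le_of_norm_le (hIz.norm.const_mul _) ?_
        filter_upwards [ae_restrict_of_ae hbd] with x hx
        rw [norm_mul]
        gcongr
    _ = s / (β - α) * ∫ x in Icc α β, ‖φ x - z‖ := integral_const_mul _ _
    _ ≤ s / (β - α) * (A * (β - α)) := by gcongr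
    _ = A * s := by field_simp

/-- Truncation of a real number to `[-K, K]`. -/
noncomputable def clamp (K x : ℝ) : ℝ := max (min x K) (-K)

theorem abs_clamp_sub_clamp_le (K x y : ℝ) : |clamp K x - clamp K y| ≤ |x - y| := by
  refine (abs_max_sub_max_le_abs _ _ _).trans ?_
  have := abs_min_sub_min_le_max x K y K
  simpa using this

/-- Truncation of the real and the imaginary part. -/
noncomputable def trunc (K : ℝ) (z : 𝕜) : 𝕜 :=
  (clamp K (RCLike.re z) : 𝕜) + (clamp K (RCLike.im z) : 𝕜) * RCLike.I

theorem norm_ofReal_add_ofReal_mul_I_le (x y : ℝ) :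
    ‖(x : 𝕜) + (y : 𝕜) * RCLike.I‖ ≤ |x| + |y| := by
  refine (norm_add_le _ _).trans ?_
  rw [norm_mul, RCLike.norm_ofReal, RCLike.norm_ofReal]
  have : ‖(RCLike.I : 𝕜)‖ ≤ 1 := by
    rcases RCLike.I_mul_I_ax (K := 𝕜) with h | h
    · simp [h]
    · have := congrArg norm h
      rw [norm_mul, norm_neg, norm_one] at this
      nlinarith [norm_nonneg (RCLike.I : 𝕜)]
  nlinarith [abs_nonneg y]

/-- Clamping is a contraction in each of the two coordinates; adding the coordinates costs the
factor `2`, which reappears in the norm of the functional. -/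
theorem norm_trunc_sub_trunc_le (K : ℝ) (z w : 𝕜) : ‖trunc K z - trunc K w‖ ≤ 2 * ‖z - w‖ := by
  have e : trunc K z - trunc K w = ((clamp K (RCLike.re z) - clamp K (RCLike.re w) : ℝ) : 𝕜)
      + ((clamp K (RCLike.im z) - clamp K (RCLike.im w) : ℝ) : 𝕜) * RCLike.I := by
    simp only [trunc]; push_cast; ring
  rw [e]
  refine (norm_ofReal_add_ofReal_mul_I_le _ _).trans ?_
  have h1 := abs_clamp_sub_clamp_le K (RCLike.re z) (RCLike.re w)
  have h2 := abs_clamp_sub_clamp_le K (RCLike.im z) (RCLike.im w)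
  have h3 := RCLike.abs_re_le_norm (z - w)
  have h4 := RCLike.abs_im_le_norm (z - w)
  rw [map_sub] at h3 h4
  linarith

theorem norm_trunc_le {K : ℝ} (hK : 0 ≤ K) (z : 𝕜) : ‖trunc K z‖ ≤ 2 * K := by
  have h : ∀ x, |clamp K x| ≤ K := fun x =>
    abs_le.2 ⟨le_max_right _ _, max_le (min_le_right _ _) (by linarith)⟩
  refine (norm_ofReal_add_ofReal_mul_I_le _ _).trans ?_
  linarith [h (RCLike.re z), h (RCLike.im z)]

theorem trunc_of_norm_le {K : ℝ} {z : 𝕜} (h : ‖z‖ ≤ K) : trunc K z = z := by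
  have hc : ∀ x : ℝ, |x| ≤ ‖z‖ → clamp K x = x := fun x hx => by
    have := abs_le.1 (hx.trans h)
    rw [clamp, min_eq_left this.2, max_eq_left this.1]
  rw [trunc, hc _ (RCLike.abs_re_le_norm z), hc _ (RCLike.abs_im_le_norm z), RCLike.re_add_im]

theorem continuous_trunc (K : ℝ) : Continuous (trunc K : 𝕜 → 𝕜) :=
  (LipschitzWith.of_dist_le_mul (K := 2) fun z w => by
    simpa [dist_eq_norm] using norm_trunc_sub_trunc_le K z w).continuous

theorem norm_trunc_le_two_mul_norm {K : ℝ} (hK : 0 ≤ K) (z : 𝕜) : ‖trunc K z‖ ≤ 2 * ‖z‖ := by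
  have := norm_trunc_sub_trunc_le K z 0
  rwa [trunc_of_norm_le (z := (0 : 𝕜)) (by simpa using hK), sub_zero, sub_zero] at this

/-- The pairing of a bounded compactly supported function in the Hardy space with a function of
bounded mean oscillation. -/
theorem H1.norm_integral_mul_le {φ : ℝ → 𝕜} (hφ : MemBMO φ) {f : H1 𝕜}
    (hf : f.BoundedCompactSupport) :
    ‖∫ x, f.toL1 x * φ x‖ ≤ 2 * bmoNorm φ * ‖f‖ := by
  have hm : ∀ n : ℕ, AEStronglyMeasurable (fun x => trunc n (φ x)) := fun n =>
    (continuous_trunc (n : ℝ)).comp_aestronglyMeasurable hφ.1.aestronglyMeasurable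
  have hn : ∀ n : ℕ, ‖∫ x, f.toL1 x * trunc n (φ x)‖ ≤ 2 * bmoNorm φ * ‖f‖ := by
    intro n
    -- The truncated pairing is continuous on `L¹`, so a bound on atoms is enough. The size of the
    -- truncation does not enter that bound.
    obtain ⟨Λ, hΛ⟩ := exists_clm_of_bounded (hm n) (fun x => norm_trunc_le n.cast_nonneg (φ x))
    rw [← hΛ]
    refine H1.norm_clm_le (fun a ha => ?_) f
    rw [hΛ]
    have hloc : LocallyIntegrable (fun x => trunc n (φ x)) :=
      (hφ.1.smul (2 : 𝕜)).mono (hm n) (Filter.Eventually.of_forall fun x => by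
        rw [Pi.smul_apply, norm_smul, RCLike.norm_ofNat]
        exact norm_trunc_le_two_mul_norm n.cast_nonneg _)
    rw [← mul_one (2 * bmoNorm φ)]
    refine ha.isBlock.norm_integral_mul_le hloc fun α β ho =>
      ⟨trunc n (⨍ y in Icc α β, φ y), ?_⟩
    have hIz : IntegrableOn (fun x => φ x - ⨍ y in Icc α β, φ y) (Icc α β) :=
      (hφ.1.integrableOn_isCompact isCompact_Icc).sub (integrableOn_const (by simp))
    calc ∫ x in Icc α β, ‖trunc n (φ x) - trunc n (⨍ y in Icc α β, φ y)‖
        ≤ ∫ x in Icc α β, 2 * ‖φ x - ⨍ y in Icc α β, φ y‖ := by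
          refine integral_mono_of_nonneg (Filter.Eventually.of_forall fun _ => norm_nonneg _)
            (hIz.norm.const_mul 2) (Filter.Eventually.of_forall fun x => ?_)
          exact norm_trunc_sub_trunc_le _ _ _
      _ = 2 * ∫ x in Icc α β, ‖φ x - ⨍ y in Icc α β, φ y‖ := integral_const_mul _ _
      _ ≤ 2 * (bmoNorm φ * (β - α)) := by
          gcongr
          exact setIntegral_oscillation_le hφ ho
      _ = 2 * bmoNorm φ * (β - α) := by ring
  have hlim : Filter.Tendsto (fun n : ℕ => ∫ x, f.toL1 x * trunc n (φ x)) Filter.atTop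
      (nhds (∫ x, f.toL1 x * φ x)) := by
    refine tendsto_integral_of_dominated_convergence (fun x => 2 * ‖f.toL1 x * φ x‖)
      (fun n => f.integrable.1.mul (hm n)) ((hf.integrable_mul hφ.1).norm.const_mul 2)
      (fun n => Filter.Eventually.of_forall fun x => ?_)
      (Filter.Eventually.of_forall fun x => ?_)
    · rw [norm_mul, norm_mul]
      nlinarith [norm_nonneg (f.toL1 x), norm_trunc_le_two_mul_norm (𝕜 := 𝕜) n.cast_nonneg (φ x)]
    · refine tendsto_const_nhds.congr' ?_
      obtain ⟨N, hN⟩ := exists_nat_ge ‖φ x‖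
      filter_upwards [Filter.eventually_ge_atTop N] with n hn
      rw [trunc_of_norm_le (hN.trans (by exact_mod_cast hn))]
  exact le_of_tendsto hlim.norm (Filter.Eventually.of_forall hn)

theorem Represents.unique {φ : ℝ → 𝕜} {L L' : H1 𝕜 →L[𝕜] 𝕜} (h : Represents φ L)
    (h' : Represents φ L') : L' = L := by
  have : Set.EqOn L' L (closure (H1.bddSupport 𝕜 : Set (H1 𝕜))) :=
    Set.EqOn.closure (fun f hf => ((h' f hf).2.trans (h f hf).2.symm)) L'.continuous L.continuous
  ext f
  exact this (H1.dense_bddSupport f)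

/-- A function of bounded mean oscillation represents a bounded functional. -/
theorem exists_represents {φ : ℝ → 𝕜} (hφ : MemBMO φ) :
    ∃ L : H1 𝕜 →L[𝕜] 𝕜, Represents φ L ∧ ‖L‖ ≤ 2 * bmoNorm φ := by
  have hi : ∀ f : H1.bddSupport 𝕜, Integrable (fun x => (f : H1 𝕜).toL1 x * φ x) := fun f =>
    H1.BoundedCompactSupport.integrable_mul f.2 hφ.1
  let T : H1.bddSupport 𝕜 →ₗ[𝕜] 𝕜 :=
    { toFun := fun f => ∫ x, (f : H1 𝕜).toL1 x * φ x
      map_add' := fun f g => by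
        rw [← integral_add (hi f) (hi g)]
        refine integral_congr_ae ?_
        filter_upwards [H1.coeFn_add (f : H1 𝕜) g] with x hx
        rw [Submodule.coe_add, hx, add_mul]
      map_smul' := fun c f => by
        rw [RingHom.id_apply, smul_eq_mul, ← integral_const_mul]
        refine integral_congr_ae ?_
        filter_upwards [H1.coeFn_smul c (f : H1 𝕜)] with x hx
        rw [Submodule.coe_smul, hx, mul_assoc] }
  let e : H1.bddSupport 𝕜 →ₗ[𝕜] H1 𝕜 := (H1.bddSupport 𝕜).subtype
  have hd : DenseRange e := by
    have := H1.dense_bddSupport (𝕜 := 𝕜)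
    simpa [DenseRange, e] using this
  have hb : ∀ f, ‖T f‖ ≤ 2 * bmoNorm φ * ‖e f‖ := fun f => H1.norm_integral_mul_le hφ f.2
  refine ⟨T.extendOfNorm e, fun f hf => ⟨hf.integrable_mul hφ.1, ?_⟩, ?_⟩
  · exact LinearMap.extendOfNorm_eq hd ⟨_, hb⟩ ⟨f, hf⟩
  · exact ContinuousLinearMap.opNorm_le_bound _
      (mul_nonneg zero_le_two ENNReal.toReal_nonneg)
      fun x => LinearMap.norm_extendOfNorm_apply_le hd _ hb x

/-! ### Dyadic intervals and the Calderón–Zygmund decomposition -/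

/-- The index of the dyadic interval of length `2⁻ⁿ` that contains `x`. -/
noncomputable def dyIdx (n : ℕ) (x : ℝ) : ℤ := ⌊2 ^ n * x⌋

/-- The dyadic interval `[k / 2 ^ n, (k + 1) / 2 ^ n)`. -/
def dyCell (n : ℕ) (k : ℤ) : Set ℝ := Ico (k / 2 ^ n) ((k + 1) / 2 ^ n)

theorem mem_dyCell {n : ℕ} {k : ℤ} {x : ℝ} : x ∈ dyCell n k ↔ dyIdx n x = k := by
  have h2 : (0 : ℝ) < 2 ^ n := by positivity
  rw [dyIdx, Int.floor_eq_iff, dyCell, mem_Ico, div_le_iff₀' h2, lt_div_iff₀' h2]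

theorem measurableSet_dyCell {n : ℕ} {k : ℤ} : MeasurableSet (dyCell n k) := measurableSet_Ico

theorem volume_real_dyCell (n : ℕ) (k : ℤ) : volume.real (dyCell n k) = (2 ^ n : ℝ)⁻¹ := by
  have h2 : (0 : ℝ) < 2 ^ n := by positivity
  rw [dyCell, Real.volume_real_Ico_of_le (by gcongr; linarith)]
  field_simp
  ring

theorem dyIdx_succ_div_two (n : ℕ) (x : ℝ) : dyIdx (n + 1) x / 2 = dyIdx n x := by
  have h := Int.floor_div_natCast (2 ^ (n + 1) * x) 2
  rw [dyIdx, dyIdx]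
  push_cast at h
  rw [← h]
  congr 1
  ring

theorem dyIdx_congr {m n : ℕ} (hmn : m ≤ n) {x y : ℝ} (h : dyIdx n x = dyIdx n y) :
    dyIdx m x = dyIdx m y := by
  induction n, hmn using Nat.le_induction with
  | base => exact h
  | succ n _ ih =>
    apply ih
    rw [← dyIdx_succ_div_two, h, dyIdx_succ_div_two]

/-- The average of `‖h‖` over the dyadic interval of generation `n` around `x`. -/
noncomputable def cellAvg (h : ℝ → 𝕜) (n : ℕ) (x : ℝ) : ℝ :=
  2 ^ n * ∫ y in dyCell n (dyIdx n x), ‖h y‖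

/-- The mean of `h` over the dyadic interval of generation `n` around `x`. -/
noncomputable def cellMean (h : ℝ → 𝕜) (n : ℕ) (x : ℝ) : 𝕜 :=
  2 ^ n * ∫ y in dyCell n (dyIdx n x), h y

theorem norm_cellMean_le (h : ℝ → 𝕜) (n : ℕ) (x : ℝ) : ‖cellMean h n x‖ ≤ cellAvg h n x := by
  rw [cellMean, cellAvg, norm_mul, norm_pow, RCLike.norm_ofNat]
  gcongr
  exact norm_integral_le_integral_norm _

theorem cellAvg_le {h : ℝ → 𝕜} {M : ℝ} (hM : ∀ x, ‖h x‖ ≤ M) (n : ℕ) (x : ℝ) :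
    cellAvg h n x ≤ M := by
  have h2 : (0 : ℝ) < 2 ^ n := by positivity
  have h1 : ‖∫ y in dyCell n (dyIdx n x), ‖h y‖‖ ≤ M * volume.real (dyCell n (dyIdx n x)) :=
    norm_setIntegral_le_of_norm_le_const (by rw [dyCell, Real.volume_Ico]; simp)
      (fun y _ => by simpa using hM y)
  rw [volume_real_dyCell, ← div_eq_mul_inv, le_div_iff₀' h2] at h1
  exact (mul_le_mul_of_nonneg_left (Real.le_norm_self _) h2.le).trans h1

theorem cellAvg_congr (h : ℝ → 𝕜) {n : ℕ} {x y : ℝ} (hxy : dyIdx n x = dyIdx n y) :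
    cellAvg h n x = cellAvg h n y := by
  rw [cellAvg, cellAvg, hxy]

/-- A cell lies in its parent and has half the length. -/
theorem cellAvg_succ_le {h : ℝ → 𝕜} (hi : Integrable h) (n : ℕ) (x : ℝ) :
    cellAvg h (n + 1) x ≤ 2 * cellAvg h n x := by
  rw [cellAvg, cellAvg, pow_succ, ← mul_assoc, mul_comm 2 (2 ^ n : ℝ)]
  refine mul_le_mul_of_nonneg_left ?_ (by positivity)
  refine setIntegral_mono_set hi.norm.integrableOn
    (Filter.Eventually.of_forall fun _ => norm_nonneg _) (LE.le.eventuallyLE ?_)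
  intro y hy
  rw [mem_dyCell] at hy ⊢
  exact dyIdx_congr n.le_succ hy

/-- Lebesgue differentiation along the cells around `x`. Up to an endpoint, each cell is the closed
ball about its midpoint with half its length as radius. -/
theorem ae_norm_le_of_cellAvg_le {h : ℝ → 𝕜} (hi : Integrable h) (t : ℝ) :
    ∀ᵐ x, (∀ n, cellAvg h n x ≤ t) → ‖h x‖ ≤ t := by
  filter_upwards [IsUnifLocDoublingMeasure.ae_tendsto_average
    (μ := (volume : Measure ℝ)) hi.norm.locallyIntegrable 1] with x hx hle
  have key := hx (ι := ℕ) (l := Filter.atTop)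
    (fun n => ((dyIdx n x : ℝ) + 1 / 2) / 2 ^ n) (fun n => (1 / 2) / 2 ^ n) ?_ ?_
  · refine le_of_tendsto key (Filter.Eventually.of_forall fun n => ?_)
    have h2 : (0 : ℝ) < 2 ^ n := by positivity
    refine le_trans (le_of_eq ?_) (hle n)
    have e1 : ((dyIdx n x : ℝ) + 1 / 2) / 2 ^ n - (1 / 2) / 2 ^ n = dyIdx n x / 2 ^ n := by ring
    have e2 : ((dyIdx n x : ℝ) + 1 / 2) / 2 ^ n + (1 / 2) / 2 ^ n = (dyIdx n x + 1) / 2 ^ n := by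
      ring
    rw [Real.closedBall_eq_Icc, e1, e2, setAverage_congr Ico_ae_eq_Icc.symm]
    change ⨍ y in dyCell n (dyIdx n x), ‖h y‖ = _
    rw [setAverage_eq, volume_real_dyCell, inv_inv, smul_eq_mul, cellAvg]
  · refine tendsto_nhdsWithin_iff.2 ⟨?_, Filter.Eventually.of_forall fun n => ?_⟩
    · have := (tendsto_pow_atTop_nhds_zero_of_lt_one (r := (1 / 2 : ℝ)) (by norm_num)
        (by norm_num)).const_mul (1 / 2)
      simpa [div_eq_mul_inv] using this
    · exact mem_Ioi.2 (by positivity)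
  · refine Filter.Eventually.of_forall fun n => ?_
    have hc : x ∈ dyCell n (dyIdx n x) := mem_dyCell.2 rfl
    rw [one_mul, Real.closedBall_eq_Icc]
    refine ⟨le_trans (le_of_eq ?_) hc.1, hc.2.le.trans (le_of_eq ?_)⟩ <;> ring

/-- The dyadic interval of generation `n` around `x` is the largest one over which the average of
`‖h‖` exceeds `t`. -/
def Stops (h : ℝ → 𝕜) (t : ℝ) (n : ℕ) (x : ℝ) : Prop :=
  t < cellAvg h n x ∧ ∀ m < n, cellAvg h m x ≤ t

theorem Stops.unique {h : ℝ → 𝕜} {t : ℝ} {m n : ℕ} {x : ℝ} (hm : Stops h t m x)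
    (hn : Stops h t n x) : m = n := by
  rcases lt_trichotomy m n with hlt | heq | hlt
  · exact absurd (hn.2 m hlt) (not_le.2 hm.1)
  · exact heq
  · exact absurd (hm.2 n hlt) (not_le.2 hn.1)

theorem Stops.congr {h : ℝ → 𝕜} {t : ℝ} {n : ℕ} {x y : ℝ} (hx : Stops h t n x)
    (hxy : dyIdx n x = dyIdx n y) : Stops h t n y := by
  refine ⟨cellAvg_congr h hxy ▸ hx.1, fun m hm => ?_⟩
  rw [← cellAvg_congr h (dyIdx_congr hm.le hxy)]
  exact hx.2 m hm

theorem exists_stops_of_lt {h : ℝ → 𝕜} {t : ℝ} {n : ℕ} {x : ℝ} (hn : t < cellAvg h n x) :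
    ∃ m, Stops h t m x := by
  classical
  have hex : ∃ n, t < cellAvg h n x := ⟨n, hn⟩
  exact ⟨Nat.find hex, Nat.find_spec hex, fun m hm => not_lt.1 (Nat.find_min hex hm)⟩

/-- The selected dyadic intervals; empty for an index that is not selected. -/
def stopSet (h : ℝ → 𝕜) (t : ℝ) (j : ℕ × ℤ) : Set ℝ := {x | dyIdx j.1 x = j.2 ∧ Stops h t j.1 x}

/-- The stopping condition involves only the cell and its ancestors, so it holds at all points of
the cell or at none. -/
theorem stopSet_eq_dyCell {h : ℝ → 𝕜} {t : ℝ} {j : ℕ × ℤ} {x : ℝ} (hx : x ∈ stopSet h t j) :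
    stopSet h t j = dyCell j.1 j.2 := by
  ext y
  rw [mem_dyCell]
  exact ⟨fun hy => hy.1, fun hy => ⟨hy, hx.2.congr (hx.1.trans hy.symm)⟩⟩

theorem stopSet_eq_empty_or (h : ℝ → 𝕜) (t : ℝ) (j : ℕ × ℤ) :
    stopSet h t j = ∅ ∨ ∃ x ∈ stopSet h t j, stopSet h t j = dyCell j.1 j.2 := by
  rcases (stopSet h t j).eq_empty_or_nonempty with h' | ⟨x, hx⟩
  · exact Or.inl h'
  · exact Or.inr ⟨x, hx, stopSet_eq_dyCell hx⟩

theorem measurableSet_stopSet (h : ℝ → 𝕜) (t : ℝ) (j : ℕ × ℤ) : MeasurableSet (stopSet h t j) := by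
  rcases stopSet_eq_empty_or h t j with h' | ⟨x, -, h'⟩
  · rw [h']; exact MeasurableSet.empty
  · rw [h']; exact measurableSet_dyCell

theorem eq_of_mem_stopSet {h : ℝ → 𝕜} {t : ℝ} {n : ℕ} {j : ℕ × ℤ} {x : ℝ}
    (hx : Stops h t n x) (hj : x ∈ stopSet h t j) : j = (n, dyIdx n x) := by
  obtain ⟨m, k⟩ := j
  obtain rfl : m = n := hj.2.unique hx
  exact Prod.ext rfl hj.1.symm

theorem pairwise_disjoint_stopSet (h : ℝ → 𝕜) (t : ℝ) :
    Pairwise (Function.onFun Disjoint (stopSet h t)) := by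
  intro i j hij
  rw [Function.onFun, Set.disjoint_left]
  intro x hi hj
  exact hij ((eq_of_mem_stopSet hi.2 hi).trans (eq_of_mem_stopSet hi.2 hj).symm)

/-- The piece of `h` on a selected dyadic interval, with its mean subtracted. -/
noncomputable def badPart (h : ℝ → 𝕜) (t : ℝ) (j : ℕ × ℤ) : ℝ → 𝕜 :=
  (stopSet h t j).indicator fun y => h y - cellMean h j.1 y

/-- On a selected cell the average of `‖h‖` exceeds `t`, so the trivial bound `2 * M` is at most `2
* M / t` times that average. The selected cells are disjoint, hence the constants sum to at most `2
* M / t * ∫ ‖h‖`. -/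
theorem isBlock_badPart {h : ℝ → 𝕜} (hi : Integrable h) {M t : ℝ} (ht : 0 < t)
    (hM : ∀ x, ‖h x‖ ≤ M) (j : ℕ × ℤ) :
    IsBlock (badPart h t j) (2 * M / t * ∫ y in stopSet h t j, ‖h y‖) := by
  have hM0 : 0 ≤ M := (norm_nonneg _).trans (hM 0)
  rcases stopSet_eq_empty_or h t j with h' | ⟨x, hx, h'⟩
  · rw [badPart, h']
    simpa using isBlock_zero (𝕜 := 𝕜)
  · obtain ⟨n, k⟩ := j
    have hst := hx.2
    obtain rfl : dyIdx n x = k := hx.1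
    simp only at h' hst
    have h2 : (0 : ℝ) < 2 ^ n := by positivity
    have e : badPart h t (n, dyIdx n x) =
        (dyCell n (dyIdx n x)).indicator fun y => h y - cellMean h n x := by
      rw [badPart, h']
      ext y
      by_cases hy : y ∈ dyCell n (dyIdx n x)
      · simp only [indicator_of_mem hy]
        rw [cellMean, cellMean, mem_dyCell.1 hy]
      · simp only [indicator_of_notMem hy]
    have hlen : ((dyIdx n x : ℝ) + 1) / 2 ^ n - dyIdx n x / 2 ^ n = (2 ^ n)⁻¹ := by ring
    have hfin : volume (dyCell n (dyIdx n x)) ≠ ∞ := by rw [dyCell, Real.volume_Ico]; simp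
    rw [e, h']
    refine ⟨(hi.1.sub aestronglyMeasurable_const).indicator measurableSet_dyCell,
      dyIdx n x / 2 ^ n, (dyIdx n x + 1) / 2 ^ n, ⟨by gcongr; linarith, ?_⟩, ?_, ?_, ?_⟩
    -- Either `0 ≤ k` or `k + 1 ≤ 0` for an integer `k`, so a dyadic cell is one-sided.
    · rcases le_or_gt 0 (dyIdx n x) with hk | hk
      · right
        have : (0 : ℝ) ≤ dyIdx n x := by exact_mod_cast hk
        positivity
      · left
        have : (dyIdx n x : ℝ) + 1 ≤ 0 := by exact_mod_cast hk
        exact div_nonpos_of_nonpos_of_nonneg this h2.le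
    · refine Filter.Eventually.of_forall fun y hy => indicator_of_notMem ?_ _
      exact fun hy' => hy (Ico_subset_Icc_self hy')
    · refine Filter.Eventually.of_forall fun y => ?_
      have h3 : 2 * M ≤ 2 * M / t * (∫ y in dyCell n (dyIdx n x), ‖h y‖) / (2 ^ n : ℝ)⁻¹ := by
        have : 2 * M / t * (∫ y in dyCell n (dyIdx n x), ‖h y‖) / (2 ^ n : ℝ)⁻¹
            = 2 * M / t * cellAvg h n x := by
          rw [cellAvg]; field_simp
        rw [this]
        calc 2 * M = 2 * M / t * t := by field_simp
          _ ≤ 2 * M / t * cellAvg h n x := by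
            have := hst.1.le
            gcongr
      rw [hlen]
      refine le_trans ?_ h3
      by_cases hy : y ∈ dyCell n (dyIdx n x)
      · rw [indicator_of_mem hy]
        refine (norm_sub_le _ _).trans ?_
        linarith [hM y, (norm_cellMean_le h n x).trans (cellAvg_le hM n x)]
      · rw [indicator_of_notMem hy, norm_zero]
        positivity
    · rw [integral_indicator measurableSet_dyCell,
        integral_sub hi.integrableOn (integrableOn_const hfin), setIntegral_const,
        volume_real_dyCell, cellMean, RCLike.real_smul_eq_coe_mul]
      push_cast
      rw [inv_mul_cancel_left₀ (pow_ne_zero _ two_ne_zero), sub_self]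

theorem hasSum_badPart_of_stops {h : ℝ → 𝕜} {t : ℝ} {n : ℕ} {x : ℝ} (hx : Stops h t n x) :
    HasSum (fun j => badPart h t j x) (h x - cellMean h n x) := by
  have h1 := hasSum_single (f := fun j => badPart h t j x) (n, dyIdx n x) (fun j hj =>
    indicator_of_notMem (fun hmem => hj (eq_of_mem_stopSet hx hmem)) _)
  have h2 : badPart h t (n, dyIdx n x) x = h x - cellMean h n x :=
    indicator_of_mem (show x ∈ stopSet h t (n, dyIdx n x) from ⟨rfl, hx⟩) _
  rwa [h2] at h1

theorem badPart_eq_zero_of_not_stops {h : ℝ → 𝕜} {t : ℝ} {x : ℝ} (hx : ¬ ∃ n, Stops h t n x)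
    (j : ℕ × ℤ) : badPart h t j x = 0 :=
  indicator_of_notMem (fun hmem => hx ⟨_, hmem.2⟩) _

/-- At most one bad part is nonzero at `x`. Partial sums thus differ from the full sum by at most
its own norm, which is the domination needed for `L¹` convergence. -/
theorem sum_badPart_eq (h : ℝ → 𝕜) (t x : ℝ) (F : Finset (ℕ × ℤ)) :
    ∑ j ∈ F, badPart h t j x = 0 ∨ ∑ j ∈ F, badPart h t j x = ∑' j, badPart h t j x := by
  by_cases hx : ∃ n, Stops h t n x
  · obtain ⟨n, hn⟩ := hx
    have hz : ∀ j, j ≠ (n, dyIdx n x) → badPart h t j x = 0 := fun j hj =>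
      indicator_of_notMem (fun hmem => hj (eq_of_mem_stopSet hn hmem)) _
    by_cases hF : (n, dyIdx n x) ∈ F
    · right
      rw [tsum_eq_single _ hz, Finset.sum_eq_single_of_mem _ hF fun j _ hj => hz j hj]
    · left
      exact Finset.sum_eq_zero fun j hj => hz j fun h' => hF (h' ▸ hj)
  · left
    exact Finset.sum_eq_zero fun j _ => badPart_eq_zero_of_not_stops hx j

/-- A bounded function with mean zero and small integral norm has a small atomic norm: the
Calderón–Zygmund decomposition at height `t`. -/
theorem H1.exists_of_bounded {h : ℝ → 𝕜} (hm : AEStronglyMeasurable h) {M t : ℝ} {p q : ℤ}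
    (ht : 0 < t) (hpq : p < q) (ho : q ≤ 0 ∨ 0 ≤ p) (hM : ∀ x, ‖h x‖ ≤ M)
    (hs : ∀ x, x ∉ Ico (p : ℝ) q → h x = 0) (h0 : ∫ x, h x = 0) (hht : ∫ x, ‖h x‖ ≤ t) :
    ∃ f : H1 𝕜, f.toL1 =ᵐ[volume] h ∧
      ‖f‖ ≤ 2 * M / t * (∫ x, ‖h x‖) + 2 * t * (q - p) := by
  have hM0 : 0 ≤ M := (norm_nonneg _).trans (hM 0)
  have hi : Integrable h := integrable_of_bounded_of_support (α := p) (β := q) hm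
    (Filter.Eventually.of_forall fun x hx => hs x fun hx' => hx (Ico_subset_Icc_self hx'))
    (Filter.Eventually.of_forall hM)
  set B : ℝ → 𝕜 := fun x => ∑' j, badPart h t j x with hB
  have hBs : ∀ n x, Stops h t n x → B x = h x - cellMean h n x := fun n x hx =>
    (hasSum_badPart_of_stops hx).tsum_eq
  have hBn : ∀ x, (¬ ∃ n, Stops h t n x) → B x = 0 := fun x hx => by
    simp only [hB, badPart_eq_zero_of_not_stops hx, tsum_zero]
  have hBsum : ∀ x, HasSum (fun j => badPart h t j x) (B x) := by
    intro x
    by_cases hx : ∃ n, Stops h t n x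
    · obtain ⟨n, hn⟩ := hx
      rw [hBs n x hn]
      exact hasSum_badPart_of_stops hn
    · rw [hBn x hx]
      simp only [badPart_eq_zero_of_not_stops hx, hasSum_zero]
  -- As `p` and `q` are integers, a cell that contains a point outside `[p, q)` is disjoint from
  -- `[p, q)`.
  have hsupp : ∀ x, x ∉ Ico (p : ℝ) q → ¬ ∃ n, Stops h t n x := by
    rintro x hx ⟨n, hn⟩
    have : cellAvg h n x = 0 := by
      rw [cellAvg, setIntegral_eq_zero_of_forall_eq_zero, mul_zero]
      intro y hy
      rw [norm_eq_zero]
      refine hs y fun hy' => hx ?_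
      have h1 := dyIdx_congr n.zero_le (mem_dyCell.1 hy)
      simp only [dyIdx, pow_zero, one_mul] at h1
      rw [mem_Ico, ← Int.le_floor, ← Int.floor_lt] at hy' ⊢
      rwa [← h1]
    exact absurd hn.1 (by rw [this]; exact not_lt.2 ht.le)
  have hBm : AEStronglyMeasurable B :=
    aestronglyMeasurable_of_tendsto_ae (Filter.atTop : Filter (Finset (ℕ × ℤ)))
      (f := fun F x => ∑ j ∈ F, badPart h t j x)
      (fun F => Finset.aestronglyMeasurable_fun_sum F fun j _ => (isBlock_badPart hi ht hM j).1)
      (Filter.Eventually.of_forall hBsum)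
  have hBb : ∀ x, ‖B x‖ ≤ 2 * M := by
    intro x
    by_cases hx : ∃ n, Stops h t n x
    · obtain ⟨n, hn⟩ := hx
      rw [hBs n x hn]
      refine (norm_sub_le _ _).trans ?_
      linarith [hM x, (norm_cellMean_le h n x).trans (cellAvg_le hM n x)]
    · rw [hBn x hx, norm_zero]
      positivity
  have hBi : Integrable B := integrable_of_bounded_of_support (α := p) (β := q) hBm
    (Filter.Eventually.of_forall fun x hx => hBn x (hsupp x fun hx' =>
      hx (Ico_subset_Icc_self hx')))
    (Filter.Eventually.of_forall hBb)
  have hsums := (hasSum_integral_iUnion (measurableSet_stopSet h t)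
    (pairwise_disjoint_stopSet h t) (f := fun x => ‖h x‖) (μ := volume)
    hi.norm.integrableOn).mul_left (2 * M / t)
  obtain ⟨fB, hfB, hfBn⟩ := H1.exists_of_hasSum_blocks (isBlock_badPart hi ht hM)
    hsums.summable hBi.norm (fun F => Filter.Eventually.of_forall fun x => by
      rcases sum_badPart_eq h t x F with h' | h'
      · rw [h', zero_sub, norm_neg]
      · rw [h', hB, sub_self, norm_zero]
        exact norm_nonneg _) hBi (Filter.Eventually.of_forall hBsum)
  -- `B` represents an element of the Hardy space, so its integral vanishes on each side.
  have hB0 : ∫ x, B x = 0 := by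
    rw [← integral_congr_ae hfB, ← integral_add_compl measurableSet_Iio fB.integrable,
      compl_Iio, fB.setIntegral_eq_zero.1, fB.setIntegral_eq_zero.2, add_zero]
  have hpq' : (0 : ℝ) < q - p := sub_pos.2 (by exact_mod_cast hpq)
  -- The good part: cell means on the selected cells, `h` itself elsewhere, bounded by `2 * t` a.e.
  have hg : IsBlock (fun x => h x - B x) (2 * t * (q - p)) := by
    refine ⟨hm.sub hBm, p, q, ⟨by exact_mod_cast hpq, by exact_mod_cast ho⟩, ?_, ?_, ?_⟩
    · refine Filter.Eventually.of_forall fun x hx => ?_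
      have hx' : x ∉ Ico (p : ℝ) q := fun hx' => hx (Ico_subset_Icc_self hx')
      change h x - B x = 0
      rw [hs x hx', hBn x (hsupp x hx'), sub_zero]
    · filter_upwards [ae_norm_le_of_cellAvg_le hi t] with x hx
      rw [mul_div_cancel_right₀ _ hpq'.ne']
      by_cases hst : ∃ n, Stops h t n x
      · obtain ⟨n, hn⟩ := hst
        rw [hBs n x hn, sub_sub_cancel]
        refine (norm_cellMean_le h n x).trans ?_
        -- A unit cell is never selected, since its average is at most `∫ ‖h‖ ≤ t`. A selected cell
        -- therefore has a parent of average at most `t`.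
        cases n with
        | zero =>
          have h1 := hn.1
          rw [cellAvg, pow_zero, one_mul] at h1
          exact absurd (h1.trans_le ((setIntegral_le_integral hi.norm
            (Filter.Eventually.of_forall fun _ => norm_nonneg _)).trans hht)) (lt_irrefl _)
        | succ n =>
          refine (cellAvg_succ_le hi n x).trans ?_
          have := hn.2 n n.lt_succ_self
          gcongr
      · rw [hBn x hst, sub_zero]
        refine (hx fun n => ?_).trans (by linarith)
        by_contra hc
        exact hst (exists_stops_of_lt (not_le.1 hc))
    · rw [integral_sub hi hBi, h0, hB0, sub_zero]
  obtain ⟨fg, hfg, hfgn⟩ := hg.exists_h1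
  refine ⟨fB + fg, ?_, (norm_add_le _ _).trans (add_le_add ?_ hfgn)⟩
  · filter_upwards [H1.coeFn_add fB fg, hfB, hfg] with x h1 h2 h3
    rw [h1, h2, h3, add_sub_cancel]
  · refine hfBn.trans ?_
    rw [hsums.tsum_eq]
    refine mul_le_mul_of_nonneg_left ?_ (by positivity)
    exact setIntegral_le_integral hi.norm (Filter.Eventually.of_forall fun _ => norm_nonneg _)

/-! ### Radon–Nikodym for continuous additive set functions -/

/-- Continuity upgrades finite to countable additivity: the part of a disjoint union left out by a
finite subfamily has small measure, hence small `m`. It also gives absolute continuity. -/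
theorem exists_density_real {X : Type*} [MeasurableSpace X] (μ : Measure X) [IsFiniteMeasure μ]
    (m : Set X → ℝ)
    (hadd : ∀ E F, MeasurableSet E → MeasurableSet F → Disjoint E F → m (E ∪ F) = m E + m F)
    (hcont : ∀ ε > 0, ∃ δ > 0, ∀ E, MeasurableSet E → μ.real E ≤ δ → |m E| ≤ ε) :
    ∃ g : X → ℝ, Integrable g μ ∧ ∀ E, MeasurableSet E → m E = ∫ x in E, g x ∂μ := by
  classical
  have hempty : m ∅ = 0 := by
    have := hadd ∅ ∅ MeasurableSet.empty MeasurableSet.empty (by simp)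
    simpa using this
  have hnull : ∀ E, MeasurableSet E → μ.real E = 0 → m E = 0 := by
    intro E hE h0
    rw [← abs_nonpos_iff]
    refine le_of_forall_pos_le_add fun ε hε => ?_
    obtain ⟨δ, hδ, h⟩ := hcont ε hε
    rw [zero_add]
    exact h E hE (by rw [h0]; exact hδ.le)
  have hsum : ∀ f : ℕ → Set X, (∀ i, MeasurableSet (f i)) → Pairwise (Function.onFun Disjoint f) →
      HasSum (fun i => m (f i)) (m (⋃ i, f i)) := by
    intro f hf hd
    have hfin : ∀ F : Finset ℕ, m (⋃ i ∈ F, f i) = ∑ i ∈ F, m (f i) := by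
      intro F
      induction F using Finset.induction_on with
      | empty => simpa using hempty
      | insert i F hi ih =>
        rw [Finset.set_biUnion_insert, Finset.sum_insert hi, ← ih]
        refine hadd _ _ (hf i) (F.measurableSet_biUnion fun j _ => hf j) ?_
        rw [Set.disjoint_iUnion₂_right]
        exact fun j hj => hd fun h => hi (h ▸ hj)
    have hμ : HasSum (fun i => μ.real (f i)) (μ.real (⋃ i, f i)) := by
      have := hasSum_integral_iUnion (μ := μ) (f := fun _ => (1 : ℝ)) hf hd
        (integrable_const _).integrableOn
      simpa using this
    rw [HasSum, Metric.tendsto_nhds]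
    intro ε hε
    obtain ⟨δ, hδ, hδm⟩ := hcont (ε / 2) (half_pos hε)
    filter_upwards [Metric.tendsto_nhds.1 hμ δ hδ] with F hF
    have hUm : MeasurableSet (⋃ i ∈ F, f i) := F.measurableSet_biUnion fun j _ => hf j
    have hsub : (⋃ i ∈ F, f i) ⊆ ⋃ i, f i := iUnion₂_subset fun i _ => subset_iUnion f i
    have h1 : m (⋃ i, f i) = ∑ i ∈ F, m (f i) + m ((⋃ i, f i) \ ⋃ i ∈ F, f i) := by
      rw [← hfin, ← hadd _ _ hUm ((MeasurableSet.iUnion hf).diff hUm) disjoint_sdiff_self_right,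
        union_sdiff_cancel hsub]
    have h2 : μ.real ((⋃ i, f i) \ ⋃ i ∈ F, f i) ≤ δ := by
      rw [measureReal_sdiff hsub hUm, measureReal_biUnion_finset (fun i _ j _ hij => hd hij)
        fun i _ => hf i]
      rw [Real.dist_eq, abs_sub_comm] at hF
      exact (le_abs_self _).trans hF.le
    have h3 := hδm _ ((MeasurableSet.iUnion hf).diff hUm) h2
    rw [Real.dist_eq, h1, sub_add_cancel_left, abs_neg]
    linarith
  let ν : SignedMeasure X :=
    { measureOf' := fun E => if MeasurableSet E then m E else 0
      empty' := by simp [hempty]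
      not_measurable' := fun E hE => by simp [hE]
      m_iUnion' := fun f hf hd => by
        simpa only [hf, MeasurableSet.iUnion hf, if_true] using hsum f hf hd }
  have hν : ∀ E, MeasurableSet E → ν E = m E := fun E hE => if_pos hE
  have hac : ν ≪ᵥ μ.toENNRealVectorMeasure := by
    refine VectorMeasure.AbsolutelyContinuous.mk fun E hE h0 => ?_
    rw [Measure.toENNRealVectorMeasure_apply_measurable hE] at h0
    rw [hν E hE]
    exact hnull E hE (by rw [measureReal_def, h0, ENNReal.toReal_zero])
  refine ⟨ν.rnDeriv μ, SignedMeasure.integrable_rnDeriv _ _, fun E hE => ?_⟩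
  rw [← hν E hE, ← withDensityᵥ_apply (SignedMeasure.integrable_rnDeriv _ _) hE,
    SignedMeasure.withDensityᵥ_rnDeriv_eq ν μ hac]

/-- The Radon–Nikodym theorem for scalar set functions. -/
theorem exists_density {X : Type*} [MeasurableSpace X] (μ : Measure X) [IsFiniteMeasure μ]
    (m : Set X → 𝕜)
    (hadd : ∀ E F, MeasurableSet E → MeasurableSet F → Disjoint E F → m (E ∪ F) = m E + m F)
    (hcont : ∀ ε > 0, ∃ δ > 0, ∀ E, MeasurableSet E → μ.real E ≤ δ → ‖m E‖ ≤ ε) :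
    ∃ g : X → 𝕜, Integrable g μ ∧ ∀ E, MeasurableSet E → m E = ∫ x in E, g x ∂μ := by
  obtain ⟨g, hg, hgm⟩ := exists_density_real μ (fun E => RCLike.re (m E))
    (fun E F hE hF h => by rw [hadd E F hE hF h, map_add]) (fun ε hε => by
      obtain ⟨δ, hδ, h⟩ := hcont ε hε
      exact ⟨δ, hδ, fun E hE hE' => (RCLike.abs_re_le_norm _).trans (h E hE hE')⟩)
  obtain ⟨g', hg', hgm'⟩ := exists_density_real μ (fun E => RCLike.im (m E))
    (fun E F hE hF h => by rw [hadd E F hE hF h, map_add]) (fun ε hε => by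
      obtain ⟨δ, hδ, h⟩ := hcont ε hε
      exact ⟨δ, hδ, fun E hE hE' => (RCLike.abs_im_le_norm _).trans (h E hE hE')⟩)
  refine ⟨fun x => (g x : 𝕜) + (g' x : 𝕜) * RCLike.I,
    hg.ofReal.add (hg'.ofReal.mul_const _), fun E hE => ?_⟩
  rw [integral_add (hg.ofReal (𝕜 := 𝕜)).restrict ((hg'.ofReal (𝕜 := 𝕜)).mul_const _).restrict,
    integral_mul_const, integral_ofReal, integral_ofReal, ← hgm E hE, ← hgm' E hE,
    RCLike.re_add_im]

/-! ### Densities of a functional on unit cells -/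

open Classical in
/-- The value of a functional on the Hardy space at a function. -/
noncomputable def applyFun (L : H1 𝕜 →L[𝕜] 𝕜) (h : ℝ → 𝕜) : 𝕜 :=
  if hh : ∃ f : H1 𝕜, f.toL1 =ᵐ[volume] h then L hh.choose else 0

/-- The choice is harmless because an element of the Hardy space is determined by its a.e. class.
The default `0` plays no role for functions in the Hardy space. -/
theorem applyFun_eq (L : H1 𝕜 →L[𝕜] 𝕜) {h : ℝ → 𝕜} {f : H1 𝕜} (hf : f.toL1 =ᵐ[volume] h) :
    applyFun L h = L f := by
  have hh : ∃ f : H1 𝕜, f.toL1 =ᵐ[volume] h := ⟨f, hf⟩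
  rw [applyFun, dif_pos hh, H1.ext_ae (hh.choose_spec.trans hf.symm)]

/-- The unit interval next to the origin, on the side of `[k, k + 1)`. -/
def sideRef (k : ℤ) : Set ℝ := if 0 ≤ k then Ico 0 1 else Ico (-1) 0

theorem measurableSet_sideRef (k : ℤ) : MeasurableSet (sideRef k) := by
  unfold sideRef; split_ifs <;> exact measurableSet_Ico

theorem volume_real_sideRef (k : ℤ) : volume.real (sideRef k) = 1 := by
  unfold sideRef; split_ifs <;> simp

/-- The correction of `u` to a function with integral zero. -/
noncomputable def corr (k : ℤ) (u : ℝ → 𝕜) : ℝ → 𝕜 :=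
  fun x => u x - (∫ y, u y) * (sideRef k).indicator 1 x

/-- Bounded measurable functions supported in `[k, k + 1)`. -/
structure CellBdd (k : ℤ) (M : ℝ) (u : ℝ → 𝕜) : Prop where
  meas : AEStronglyMeasurable u
  bdd : ∀ x, ‖u x‖ ≤ M
  supp : ∀ x, x ∉ Ico (k : ℝ) (k + 1) → u x = 0

namespace CellBdd

variable {k : ℤ} {M M' : ℝ} {u v : ℝ → 𝕜}

theorem integrable (h : CellBdd k M u) : Integrable u :=
  integrable_of_bounded_of_support (α := k) (β := k + 1) h.meas
    (Filter.Eventually.of_forall fun x hx => h.supp x fun hx' => hx (Ico_subset_Icc_self hx'))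
    (Filter.Eventually.of_forall h.bdd)

theorem add (h : CellBdd k M u) (h' : CellBdd k M' v) :
    CellBdd k (M + M') (fun x => u x + v x) :=
  ⟨h.meas.add h'.meas, fun x => norm_add_le_of_le (h.bdd x) (h'.bdd x), fun x hx => by
    rw [h.supp x hx, h'.supp x hx, add_zero]⟩

theorem const_mul (h : CellBdd k M u) (c : 𝕜) : CellBdd k (‖c‖ * M) (fun x => c * u x) :=
  ⟨h.meas.const_mul c, fun x => by
    rw [norm_mul]
    gcongr
    exact h.bdd x, fun x hx => by rw [h.supp x hx, mul_zero]⟩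

theorem indicator {w : ℝ → 𝕜} (hm : AEStronglyMeasurable w) (hb : ∀ x, ‖w x‖ ≤ M) :
    CellBdd k M ((Ico (k : ℝ) (k + 1)).indicator w) :=
  ⟨hm.indicator measurableSet_Ico, fun x => (norm_indicator_le_norm_self _ _).trans (hb x),
    fun _ hx => indicator_of_notMem hx _⟩

theorem norm_integral_le (h : CellBdd k M u) : ‖∫ x, u x‖ ≤ M := by
  have : ∫ x, u x = ∫ x in Ico (k : ℝ) (k + 1), u x := by
    rw [setIntegral_eq_integral_of_forall_compl_eq_zero h.supp]
  rw [this]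
  have := norm_setIntegral_le_of_norm_le_const (μ := volume) (s := Ico (k : ℝ) (k + 1)) (f := u)
    (C := M) (by simp) (fun x _ => h.bdd x)
  simpa using this

theorem norm_indicator_one_le (s : Set ℝ) (x : ℝ) : ‖s.indicator (1 : ℝ → 𝕜) x‖ ≤ 1 :=
  (norm_indicator_le_norm_self _ _).trans (by simp)

theorem integrable_indicator_sideRef (k : ℤ) :
    Integrable ((sideRef k).indicator (1 : ℝ → 𝕜)) := by
  refine (integrable_indicator_iff (measurableSet_sideRef k)).2 (integrableOn_const ?_)
  intro h
  have := volume_real_sideRef k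
  rw [measureReal_def, h] at this
  simp at this

theorem integral_indicator_sideRef (k : ℤ) :
    ∫ x, (sideRef k).indicator (1 : ℝ → 𝕜) x = 1 := by
  rw [integral_indicator (measurableSet_sideRef k)]
  simp [volume_real_sideRef]

/-- The correction at most doubles both the sup bound and the `L¹` norm. The cell and the reference
interval lie in a one-sided interval with integer endpoints and length at most `|k| + 1`, to which
`H1.exists_of_bounded` applies. -/
theorem exists_h1 (k : ℤ) {M : ℝ} {u : ℝ → 𝕜} {t : ℝ} (ht : 0 < t) (h : CellBdd k M u)
    (hut : 2 * ∫ x, ‖u x‖ ≤ t) :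
    ∃ f : H1 𝕜, f.toL1 =ᵐ[volume] corr k u ∧
      ‖f‖ ≤ 2 * (2 * M) / t * (2 * ∫ x, ‖u x‖) + 2 * t * (|k| + 1) := by
  have hM0 : 0 ≤ M := (norm_nonneg _).trans (h.bdd 0)
  have hri := integrable_indicator_sideRef (𝕜 := 𝕜) k
  obtain ⟨p, q, hpq, ho, hk, hr, hle⟩ : ∃ p q : ℤ, p < q ∧ (q ≤ 0 ∨ 0 ≤ p) ∧
      Ico (k : ℝ) (k + 1) ⊆ Ico p q ∧ sideRef k ⊆ Ico p q ∧ (q : ℝ) - p ≤ |k| + 1 := by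
    rcases le_or_gt 0 k with hk | hk
    · have hk' : (0 : ℝ) ≤ k := by exact_mod_cast hk
      refine ⟨0, k + 1, by omega, Or.inr le_rfl, ?_, ?_, ?_⟩
      · exact Ico_subset_Ico (by simpa using hk') (by simp)
      · rw [sideRef, if_pos hk]
        exact Ico_subset_Ico (by simp) (by simpa using hk')
      · rw [abs_of_nonneg hk]; simp
    · have hk' : (k : ℝ) + 1 ≤ 0 := by exact_mod_cast hk
      refine ⟨k, 0, hk, Or.inl le_rfl, ?_, ?_, ?_⟩
      · exact Ico_subset_Ico le_rfl (by simpa using hk')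
      · rw [sideRef, if_neg (not_le.2 hk)]
        exact Ico_subset_Ico (by linarith) (by simp)
      · rw [abs_of_neg hk]; push_cast; linarith
  have hnle : ∫ x, ‖corr k u x‖ ≤ 2 * ∫ x, ‖u x‖ := by
    calc ∫ x, ‖corr k u x‖
        ≤ ∫ x, (‖u x‖ + ‖∫ y, u y‖ * ‖(sideRef k).indicator (1 : ℝ → 𝕜) x‖) := by
          refine integral_mono_of_nonneg (Filter.Eventually.of_forall fun _ => norm_nonneg _)
            (h.integrable.norm.add (hri.norm.const_mul _)) (Filter.Eventually.of_forall fun x => ?_)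
          exact (norm_sub_le _ _).trans (by rw [norm_mul])
      _ = (∫ x, ‖u x‖) + ‖∫ y, u y‖ := by
          rw [integral_add h.integrable.norm (hri.norm.const_mul _), integral_const_mul]
          have : ∀ x, ‖(sideRef k).indicator (1 : ℝ → 𝕜) x‖ = (sideRef k).indicator 1 x := by
            intro x
            by_cases hx : x ∈ sideRef k <;> simp [hx]
          simp only [this]
          rw [integral_indicator_sideRef, mul_one]
      _ ≤ 2 * ∫ x, ‖u x‖ := by
          have := norm_integral_le_integral_norm (μ := volume) u
          linarith
  have hb : ∀ x, ‖corr k u x‖ ≤ 2 * M := fun x => by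
    refine (norm_sub_le _ _).trans ?_
    rw [norm_mul, two_mul]
    refine add_le_add (h.bdd x) ?_
    exact (mul_le_mul h.norm_integral_le (norm_indicator_one_le _ _) (norm_nonneg _) hM0).trans_eq
      (mul_one M)
  have hs : ∀ x, x ∉ Ico (p : ℝ) q → corr k u x = 0 := fun x hx => by
    rw [corr, h.supp x fun h' => hx (hk h'), indicator_of_notMem fun h' => hx (hr h'), mul_zero,
      sub_zero]
  have h0 : ∫ x, corr k u x = 0 := by
    unfold corr
    rw [integral_sub h.integrable (hri.const_mul _), integral_const_mul,
      integral_indicator_sideRef, mul_one, sub_self]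
  obtain ⟨f, hf, hfn⟩ := H1.exists_of_bounded (h := corr k u)
    (h.meas.sub (hri.1.const_mul _)) ht hpq ho hb hs h0
    (hnle.trans hut)
  refine ⟨f, hf, hfn.trans ?_⟩
  gcongr

theorem exists_corr (h : CellBdd k M u) : ∃ f : H1 𝕜, f.toL1 =ᵐ[volume] corr k u := by
  have h0 : 0 ≤ ∫ x, ‖u x‖ := integral_nonneg fun _ => norm_nonneg _
  obtain ⟨f, hf, -⟩ := exists_h1 k (t := 2 * (∫ x, ‖u x‖) + 1) (by linarith) h (by linarith)
  exact ⟨f, hf⟩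

theorem applyFun_add (L : H1 𝕜 →L[𝕜] 𝕜) (h : CellBdd k M u) (h' : CellBdd k M' v) :
    applyFun L (corr k fun x => u x + v x) = applyFun L (corr k u) + applyFun L (corr k v) := by
  obtain ⟨f, hf⟩ := h.exists_corr
  obtain ⟨g, hg⟩ := h'.exists_corr
  rw [applyFun_eq L hf, applyFun_eq L hg, ← map_add]
  refine applyFun_eq L ?_
  filter_upwards [H1.coeFn_add f g, hf, hg] with x h1 h2 h3
  rw [h1, h2, h3, corr, corr, corr, integral_add h.integrable h'.integrable]
  ring

theorem applyFun_const_mul (L : H1 𝕜 →L[𝕜] 𝕜) (h : CellBdd k M u) (c : 𝕜) :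
    applyFun L (corr k fun x => c * u x) = c * applyFun L (corr k u) := by
  obtain ⟨f, hf⟩ := h.exists_corr
  rw [applyFun_eq L hf, ← smul_eq_mul, ← map_smul]
  refine applyFun_eq L ?_
  filter_upwards [H1.coeFn_smul c f, hf] with x h1 h2
  rw [h1, h2, corr, corr, integral_const_mul, mul_sub, mul_assoc]

/-- Among functions with a common bound, the functional is continuous for the `L¹` norm. -/
theorem norm_applyFun_le (L : H1 𝕜 →L[𝕜] 𝕜) (k : ℤ) (M : ℝ) {ε : ℝ} (hε : 0 < ε) :
    ∃ δ > 0, ∀ u : ℝ → 𝕜, CellBdd k M u → ∫ x, ‖u x‖ ≤ δ → ‖applyFun L (corr k u)‖ ≤ ε := by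
  by_cases hM : 0 ≤ M
  swap
  · exact ⟨1, one_pos, fun u hu => absurd ((norm_nonneg _).trans (hu.bdd 0)) hM⟩
  set N : ℝ := ‖L‖ + 1 with hN
  have hN0 : 0 < N := by positivity
  set t : ℝ := ε / N / (4 * (|k| + 1)) with ht
  have hk : (0 : ℝ) < |(k : ℝ)| + 1 := by positivity
  have ht0 : 0 < t := by
    have : (0 : ℝ) < ((|k| : ℤ) : ℝ) + 1 := by push_cast; exact hk
    positivity
  -- The height `t` makes the good term equal to `ε / N / 2`. The first entry of the minimum makes
  -- `t` admissible; the second brings the bad term below `ε / N / 2`.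
  refine ⟨min (t / 2) (ε / N / 2 * t / (8 * (M + 1))), by positivity, fun u hu hle => ?_⟩
  have h1 : 2 * ∫ x, ‖u x‖ ≤ t := by linarith [hle.trans (min_le_left _ _)]
  obtain ⟨f, hf, hfn⟩ := exists_h1 k ht0 hu h1
  rw [applyFun_eq L hf]
  have h2 : 2 * (2 * M) / t * (2 * ∫ x, ‖u x‖) ≤ ε / N / 2 := by
    have h3 := hle.trans (min_le_right _ _)
    calc 2 * (2 * M) / t * (2 * ∫ x, ‖u x‖) ≤ 2 * (2 * M) / t *
          (2 * (ε / N / 2 * t / (8 * (M + 1)))) := by gcongr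
      _ = (ε / N / 2) * (M / (M + 1)) := by field_simp; ring
      _ ≤ (ε / N / 2) * 1 := by
        gcongr
        rw [div_le_one (by linarith)]
        linarith
      _ = ε / N / 2 := mul_one _
  have h4 : 2 * t * (|k| + 1) = ε / N / 2 := by
    rw [ht]
    have : ((|k| : ℤ) : ℝ) + 1 ≠ 0 := by push_cast; exact hk.ne'
    field_simp
    ring
  have h5 : ‖f‖ ≤ ε / N := by linarith
  calc ‖L f‖ ≤ ‖L‖ * ‖f‖ := L.le_opNorm f
    _ ≤ N * (ε / N) := by
      gcongr
      linarith
    _ = ε := by field_simp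

end CellBdd

theorem CellBdd.indicator_one (k : ℤ) {E : Set ℝ} (hE : MeasurableSet E) :
    CellBdd k 1 ((Ico (k : ℝ) (k + 1)).indicator (E.indicator (1 : ℝ → 𝕜))) :=
  CellBdd.indicator ((stronglyMeasurable_const.indicator hE).aestronglyMeasurable)
    (CellBdd.norm_indicator_one_le _)

/-- On the unit interval `[k, k + 1)` a functional is given by a density on sets. -/
theorem exists_density_cell (L : H1 𝕜 →L[𝕜] 𝕜) (k : ℤ) :
    ∃ g : ℝ → 𝕜, IntegrableOn g (Ico (k : ℝ) (k + 1)) ∧ ∀ E, MeasurableSet E →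
      applyFun L (corr k ((Ico (k : ℝ) (k + 1)).indicator (E.indicator 1)))
        = ∫ x in E, g x ∂(volume.restrict (Ico (k : ℝ) (k + 1))) := by
  refine exists_density (volume.restrict (Ico (k : ℝ) (k + 1)))
    (fun E => applyFun L (corr k ((Ico (k : ℝ) (k + 1)).indicator (E.indicator 1)))) ?_ ?_
  · intro E F hE hF hd
    rw [← CellBdd.applyFun_add L (.indicator_one k hE) (.indicator_one k hF)]
    congr 2
    rw [indicator_union_of_disjoint hd, indicator_add]
  · intro ε hε
    obtain ⟨δ, hδ, h⟩ := CellBdd.norm_applyFun_le L k 1 hε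
    refine ⟨δ, hδ, fun E hE hle => h _ (.indicator_one k hE) (le_of_eq_of_le ?_ hle)⟩
    rw [measureReal_restrict_apply hE, inter_comm, ← integral_indicator_one
      (measurableSet_Ico.inter hE)]
    congr 1
    ext x
    rw [indicator_indicator]
    by_cases hx : x ∈ Ico (k : ℝ) (k + 1) ∩ E
    · simp only [indicator_of_mem hx, Pi.one_apply, norm_one]
    · simp only [indicator_of_notMem hx, norm_zero]

/-- On the unit interval `[k, k + 1)` a functional is given by a density. -/
theorem exists_density_cell_bounded (L : H1 𝕜 →L[𝕜] 𝕜) (k : ℤ) :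
    ∃ g : ℝ → 𝕜, IntegrableOn g (Ico (k : ℝ) (k + 1)) ∧ ∀ M u, CellBdd k M u →
      applyFun L (corr k u) = ∫ x in Ico (k : ℝ) (k + 1), u x * g x := by
  obtain ⟨g, hg, hgE⟩ := exists_density_cell L k
  refine ⟨g, hg, fun M u hu => ?_⟩
  set C : Set ℝ := Ico (k : ℝ) (k + 1) with hC
  have hsb : ∀ s : SimpleFunc ℝ 𝕜, ∃ M, CellBdd k M (C.indicator s) := fun s => by
    obtain ⟨M, hM⟩ := s.exists_forall_norm_le
    exact ⟨M, CellBdd.indicator s.stronglyMeasurable.aestronglyMeasurable hM⟩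
  have hsi : ∀ s : SimpleFunc ℝ 𝕜, IntegrableOn (fun x => s x * g x) C := fun s => by
    obtain ⟨M, hM⟩ := s.exists_forall_norm_le
    exact hg.bdd_mul (c := M) s.stronglyMeasurable.aestronglyMeasurable
      (Filter.Eventually.of_forall hM)
  have hs : ∀ s : SimpleFunc ℝ 𝕜, applyFun L (corr k (C.indicator s)) = ∫ x in C, s x * g x := by
    intro s
    induction s using SimpleFunc.induction with
    | const c hE =>
      rename_i E
      have e1 : (C.indicator (SimpleFunc.piecewise E hE (SimpleFunc.const ℝ c)
          (SimpleFunc.const ℝ 0)) : ℝ → 𝕜) = fun x => c * C.indicator (E.indicator 1) x := by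
        ext x
        by_cases hx : x ∈ C <;> by_cases hx' : x ∈ E <;> simp [hx, hx']
      have e2 : ∀ x, (SimpleFunc.piecewise E hE (SimpleFunc.const ℝ c)
          (SimpleFunc.const ℝ 0)) x * g x = E.indicator (fun x => c * g x) x := by
        intro x
        by_cases hx' : x ∈ E <;> simp [hx']
      rw [e1, CellBdd.applyFun_const_mul L (CellBdd.indicator_one k hE), hgE E hE]
      simp only [e2]
      rw [integral_indicator hE, integral_const_mul]
    | add hd hf hf' =>
      rename_i s s'
      obtain ⟨M, hM⟩ := hsb s
      obtain ⟨M', hM'⟩ := hsb s'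
      have e1 : (C.indicator (s + s' : SimpleFunc ℝ 𝕜) : ℝ → 𝕜) =
          fun x => C.indicator s x + C.indicator s' x := by
        rw [SimpleFunc.coe_add, indicator_add']
        rfl
      rw [e1, CellBdd.applyFun_add L hM hM', hf, hf', ← integral_add (hsi s) (hsi s')]
      simp [add_mul]
  have hM0 : 0 ≤ M := (norm_nonneg _).trans (hu.bdd 0)
  have hw := hu.meas.stronglyMeasurable_mk
  have hwb : ∀ᵐ x, ‖hu.meas.mk u x‖ ≤ M := by
    filter_upwards [hu.meas.ae_eq_mk] with x hx
    rw [← hx]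
    exact hu.bdd x
  -- The approximants must share the bound `M`, since `L¹` continuity of the functional is known
  -- only among uniformly bounded functions.
  set s : ℕ → SimpleFunc ℝ 𝕜 := hw.approxBounded M with hsdef
  have hsbd : ∀ n x, ‖s n x‖ ≤ M := fun n x => hw.norm_approxBounded_le hM0 n x
  have hslim : ∀ᵐ x, Filter.Tendsto (fun n => s n x) Filter.atTop (nhds (u x)) := by
    filter_upwards [hw.tendsto_approxBounded_ae hwb, hu.meas.ae_eq_mk] with x h1 h2
    rwa [h2]
  have hcb : ∀ n, CellBdd k M (C.indicator (s n)) := fun n =>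
    CellBdd.indicator (s n).stronglyMeasurable.aestronglyMeasurable (hsbd n)
  have hdb : ∀ n, CellBdd k (M + M) (fun x => C.indicator (s n) x - u x) := fun n => by
    have := (hcb n).add (hu.const_mul (-1))
    simpa [sub_eq_add_neg] using this
  have hi0 : Filter.Tendsto (fun n => ∫ x, ‖C.indicator (s n) x - u x‖) Filter.atTop
      (nhds (∫ _ : ℝ, (0 : ℝ))) := by
    have hCi : Integrable (C.indicator fun _ => M + M) :=
      (integrable_indicator_iff measurableSet_Ico).2 (integrableOn_const (by simp))
    refine tendsto_integral_of_dominated_convergence (C.indicator fun _ => M + M)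
      (fun n => (hdb n).meas.norm) hCi (fun n => Filter.Eventually.of_forall fun x => ?_) ?_
    · rw [norm_norm]
      by_cases hx : x ∈ C
      · rw [indicator_of_mem hx (fun _ => M + M)]
        exact (hdb n).bdd x
      · rw [(hdb n).supp x hx, indicator_of_notMem hx, norm_zero]
    · filter_upwards [hslim] with x hx
      by_cases hxC : x ∈ C
      · simp only [indicator_of_mem hxC]
        exact tendsto_iff_norm_sub_tendsto_zero.1 hx
      · simp only [indicator_of_notMem hxC, hu.supp x hxC, sub_self, norm_zero]
        exact tendsto_const_nhds
  rw [integral_zero] at hi0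
  have hlimL : Filter.Tendsto (fun n => applyFun L (corr k (C.indicator (s n)))) Filter.atTop
      (nhds (applyFun L (corr k u))) := by
    rw [Metric.tendsto_nhds]
    intro ε hε
    obtain ⟨δ, hδ, h⟩ := CellBdd.norm_applyFun_le L k (M + M) (half_pos hε)
    filter_upwards [hi0.eventually_le_const hδ] with n hn
    have e1 : applyFun L (corr k (C.indicator (s n))) =
        applyFun L (corr k fun x => C.indicator (s n) x - u x) + applyFun L (corr k u) := by
      rw [← CellBdd.applyFun_add L (hdb n) hu]
      simp
    rw [dist_eq_norm, e1, add_sub_cancel_right]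
    linarith [h _ (hdb n) hn]
  have hlimI : Filter.Tendsto (fun n => ∫ x in C, s n x * g x) Filter.atTop
      (nhds (∫ x in C, u x * g x)) := by
    refine tendsto_integral_of_dominated_convergence (fun x => M * ‖g x‖)
      (fun n => (hsi (s n)).1) (hg.norm.const_mul M)
      (fun n => Filter.Eventually.of_forall fun x => ?_) ?_
    · rw [norm_mul]
      gcongr
      exact hsbd n x
    · filter_upwards [ae_restrict_of_ae hslim] with x hx
      exact hx.mul_const _
  refine tendsto_nhds_unique hlimL ?_
  simpa only [hs] using hlimI

/-! ### Gluing the densities -/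

/-- A functional on the Hardy space is given on blocks by a locally integrable function. -/
theorem exists_locallyIntegrable_density (L : H1 𝕜 →L[𝕜] 𝕜) :
    ∃ φ : ℝ → 𝕜, LocallyIntegrable φ ∧ ∀ (b : ℝ → 𝕜) (s : ℝ) (f : H1 𝕜), IsBlock b s →
      f.toL1 =ᵐ[volume] b → L f = ∫ x, b x * φ x := by
  choose g hg hgu using exists_density_cell_bounded L
  set φ : ℝ → 𝕜 := fun x => g ⌊x⌋ x with hφ
  have hfl : ∀ (k : ℤ) (x : ℝ), x ∈ Ico (k : ℝ) (k + 1) ↔ ⌊x⌋ = k := fun k x => by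
    rw [Int.floor_eq_iff, mem_Ico]
  have hφk : ∀ k : ℤ, EqOn (g k) φ (Ico (k : ℝ) (k + 1)) := fun k x hx => by
    simp only [hφ, (hfl k x).1 hx]
  have hφi : ∀ k : ℤ, IntegrableOn φ (Ico (k : ℝ) (k + 1)) := fun k =>
    (hg k).congr_fun (hφk k) measurableSet_Ico
  have hloc : LocallyIntegrable φ := by
    rw [locallyIntegrable_iff]
    intro K hK
    obtain ⟨R, hR⟩ := hK.isBounded.subset_closedBall 0
    have hsub : K ⊆ ⋃ k ∈ Finset.Icc ⌊-R⌋ ⌊R⌋, Ico (k : ℝ) (k + 1) := by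
      intro x hx
      have := hR hx
      rw [Real.closedBall_eq_Icc, zero_sub, zero_add] at this
      simp only [mem_iUnion]
      exact ⟨⌊x⌋, Finset.mem_Icc.2 ⟨Int.floor_mono this.1, Int.floor_mono this.2⟩,
        (hfl _ _).2 rfl⟩
    exact (integrableOn_finset_iUnion.2 fun k _ => hφi k).mono_set hsub
  refine ⟨φ, hloc, ?_⟩
  have main : ∀ (h : ℝ → 𝕜) (M : ℝ) (p q : ℤ) (f : H1 𝕜), AEStronglyMeasurable h →
      (q ≤ 0 ∨ 0 ≤ p) → (∀ x, ‖h x‖ ≤ M) → (∀ x, x ∉ Ico (p : ℝ) q → h x = 0) →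
      ∫ x, h x = 0 → f.toL1 =ᵐ[volume] h → L f = ∫ x, h x * φ x := by
    intro h M p q f hm ho hM hs h0 hf
    have hcb : ∀ k : ℤ, CellBdd k M ((Ico (k : ℝ) (k + 1)).indicator h) := fun k =>
      CellBdd.indicator hm hM
    choose F hF using fun k => (hcb k).exists_corr
    have hsumh : ∀ x, ∑ k ∈ Finset.Ico p q, (Ico (k : ℝ) (k + 1)).indicator h x = h x := by
      intro x
      by_cases hx : x ∈ Ico (p : ℝ) q
      · have hx' : ⌊x⌋ ∈ Finset.Ico p q := by
          rw [Finset.mem_Ico, Int.le_floor, Int.floor_lt]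
          exact hx
        rw [Finset.sum_eq_single_of_mem _ hx' fun k _ hk =>
          indicator_of_notMem (fun hk' => hk ((hfl k x).1 hk').symm) _]
        exact indicator_of_mem ((hfl _ _).2 rfl) _
      · rw [hs x hx]
        refine Finset.sum_eq_zero fun k _ => ?_
        by_cases hk : x ∈ Ico (k : ℝ) (k + 1)
        · rw [indicator_of_mem hk, hs x hx]
        · exact indicator_of_notMem hk _
    have hsumi : ∑ k ∈ Finset.Ico p q, ∫ x, (Ico (k : ℝ) (k + 1)).indicator h x = 0 := by
      rw [← integral_finsetSum _ fun k _ => (hcb k).integrable]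
      simp only [hsumh, h0]
    obtain ⟨S, hS⟩ : ∃ S, ∀ k ∈ Finset.Ico p q, sideRef k = S := by
      rcases ho with ho | ho
      · exact ⟨Ico (-1) 0, fun k hk => if_neg (by have := Finset.mem_Ico.1 hk; omega)⟩
      · exact ⟨Ico 0 1, fun k hk => if_pos (by have := Finset.mem_Ico.1 hk; omega)⟩
    -- All cells involved share the reference interval `S`, so the corrections add up to `(∫ h) *
    -- 1_S = 0`.
    have hFf : f = ∑ k ∈ Finset.Ico p q, F k := by
      refine H1.toL1_injective (Lp.ext ?_)
      rw [map_sum]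
      have hF' : ∀ᵐ x, ∀ k, (F k).toL1 x = corr k ((Ico (k : ℝ) (k + 1)).indicator h) x :=
        ae_all_iff.2 hF
      filter_upwards [hf, hF', Lp.coeFn_finsetSum (Finset.Ico p q) fun k => (F k).toL1]
        with x h1 h2 h3
      rw [h1, h3, Finset.sum_apply]
      simp only [h2, corr]
      rw [Finset.sum_sub_distrib, hsumh, Finset.sum_congr rfl fun k hk => by rw [hS k hk],
        ← Finset.sum_mul, hsumi, zero_mul, sub_zero]
    have hLF : ∀ k, L (F k) = ∫ x, (Ico (k : ℝ) (k + 1)).indicator (fun x => h x * φ x) x := by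
      intro k
      rw [← applyFun_eq L (hF k), hgu k M _ (hcb k), integral_indicator measurableSet_Ico]
      refine setIntegral_congr_fun measurableSet_Ico fun x hx => ?_
      simp only [indicator_of_mem hx, hφk k hx]
    rw [hFf, map_sum]
    simp only [hLF]
    rw [← integral_finsetSum]
    · congr 1
      ext x
      rw [← hsumh x, Finset.sum_mul]
      refine Finset.sum_congr rfl fun k _ => ?_
      rw [indicator_mul_left]
    · intro k _
      rw [integrable_indicator_iff measurableSet_Ico]
      exact (hφi k).bdd_mul (c := M) hm.restrict (Filter.Eventually.of_forall hM)
  intro b s f hb hf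
  obtain ⟨hm, α, β, ho, hs, hbd, hi⟩ := hb
  -- For an interval to the left of the origin, `q = 0` and `[p, q)` may miss the endpoint `0`; this
  -- null point is excluded.
  obtain ⟨p, q, hpq, hsub⟩ : ∃ p q : ℤ, (q ≤ 0 ∨ 0 ≤ p) ∧
      ∀ x, x ≠ 0 → x ∈ Icc α β → x ∈ Ico (p : ℝ) q := by
    rcases ho.2 with h | h
    · refine ⟨⌊α⌋, 0, Or.inl le_rfl, fun x hx hx' => ⟨(Int.floor_le α).trans hx'.1, ?_⟩⟩
      rw [Int.cast_zero]
      exact lt_of_le_of_ne (hx'.2.trans h) hx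
    · refine ⟨0, ⌊β⌋ + 1, Or.inr le_rfl, fun x _ hx' => ⟨?_, ?_⟩⟩
      · rw [Int.cast_zero]
        exact h.trans hx'.1
      · push_cast
        exact hx'.2.trans_lt (Int.lt_floor_add_one β)
  classical
  -- A modification on a null set makes the support and size conditions hold everywhere, as `main`
  -- requires.
  set b' : ℝ → 𝕜 := fun x => if x ∈ Ico (p : ℝ) q ∧ ‖b x‖ ≤ s / (β - α) then b x else 0 with hb'
  have hne : ∀ᵐ x : ℝ, x ≠ 0 := by simp [ae_iff]
  have hbb' : b =ᵐ[volume] b' := by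
    filter_upwards [hs, hbd, hne] with x h1 h2 h3
    simp only [hb']
    split_ifs with hx
    · rfl
    · exact h1 fun hx' => hx ⟨hsub x h3 hx', h2⟩
  have hM : 0 ≤ s / (β - α) := by
    obtain ⟨x, hx⟩ := hbd.exists
    exact (norm_nonneg _).trans hx
  rw [main b' (s / (β - α)) p q f (hm.congr hbb') hpq (fun x => ?_) (fun x hx => ?_)
    (by rw [← integral_congr_ae hbb', hi]) (hf.trans hbb')]
  · refine integral_congr_ae ?_
    filter_upwards [hbb'] with x hx
    rw [hx]
  · simp only [hb']
    split_ifs with hx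
    · exact hx.2
    · rwa [norm_zero]
  · exact if_neg fun hx' => hx hx'.1

/-! ### From blocks to mean oscillation -/

/-- A bound for the pairing with blocks bounds the mean oscillation. -/
theorem setIntegral_oscillation_le_of_blocks {η : ℝ → 𝕜} (hη : LocallyIntegrable η) {A : ℝ}
    (hA : ∀ b s, IsBlock b s → ‖∫ x, b x * η x‖ ≤ A * s) {α β : ℝ} (ho : OneSided α β) :
    ∫ x in Icc α β, ‖η x - ⨍ y in Icc α β, η y‖ ≤ 2 * A * (β - α) := by
  have hpos : 0 < β - α := sub_pos.2 ho.1
  set I : Set ℝ := Icc α β with hI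
  have hvol : volume.real I = β - α := by rw [hI, Real.volume_real_Icc_of_le ho.1.le]
  have hfin : volume I ≠ ∞ := by simp [hI]
  have hIη : IntegrableOn η I := hη.integrableOn_isCompact isCompact_Icc
  set c : 𝕜 := ⨍ y in I, η y with hc
  have hIc : IntegrableOn (fun x => η x - c) I := hIη.sub (integrableOn_const hfin)
  have hc0 : ∫ x in I, (η x - c) = 0 := by
    rw [integral_sub hIη (integrableOn_const hfin), setIntegral_const, hvol, hc, setAverage_eq,
      hvol, smul_inv_smul₀ hpos.ne', sub_self]
  -- The conjugate phase of `η - c`, equal to `0` where `η = c`. Subtracting its mean `a` gives a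
  -- block bounded by `2`, whence the factor `2`.
  set g : ℝ → 𝕜 := fun x => ((‖η x - c‖ : ℝ) : 𝕜)⁻¹ * (starRingEnd 𝕜) (η x - c) with hg
  have hgm : AEStronglyMeasurable g := by
    have h1 : AEStronglyMeasurable (fun x => η x - c) :=
      hη.aestronglyMeasurable.sub aestronglyMeasurable_const
    have h2 : AEStronglyMeasurable (fun x => ((‖η x - c‖ : ℝ) : 𝕜)⁻¹) :=
      ((RCLike.measurable_ofReal.comp_aemeasurable h1.norm.aemeasurable).inv).aestronglyMeasurable
    exact h2.mul (RCLike.continuous_conj.comp_aestronglyMeasurable h1)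
  have hgb : ∀ x, ‖g x‖ ≤ 1 := fun x => by
    rw [hg, norm_mul, norm_inv, RCLike.norm_ofReal, abs_norm, RCLike.norm_conj]
    exact inv_mul_le_one
  have hgmul : ∀ x, g x * (η x - c) = ((‖η x - c‖ : ℝ) : 𝕜) := fun x => by
    rw [hg]
    simp only
    rw [mul_assoc, RCLike.conj_mul]
    rcases eq_or_ne (‖η x - c‖) 0 with h0 | h0
    · simp [h0]
    · have : ((‖η x - c‖ : ℝ) : 𝕜) ≠ 0 := by exact_mod_cast h0
      field_simp
  have hgi : IntegrableOn g I :=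
    (integrableOn_const (C := (1 : ℝ)) hfin).mono' hgm.restrict (Filter.Eventually.of_forall hgb)
  set a : 𝕜 := ⨍ x in I, g x with ha
  have hab : ‖a‖ ≤ 1 := by
    rw [ha, setAverage_eq, hvol, norm_smul, norm_inv, Real.norm_of_nonneg hpos.le,
      inv_mul_le_iff₀ hpos]
    have := norm_setIntegral_le_of_norm_le_const (μ := volume) (s := I) (f := g) (C := 1)
      (by simp [hI]) (fun x _ => hgb x)
    rwa [hvol, mul_comm] at this
  have hga0 : ∫ x in I, (g x - a) = 0 := by
    rw [integral_sub hgi (integrableOn_const hfin), setIntegral_const, hvol, ha, setAverage_eq,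
      hvol, smul_inv_smul₀ hpos.ne', sub_self]
  have hblock : IsBlock (I.indicator fun x => g x - a) (2 * (β - α)) := by
    refine ⟨(hgm.sub aestronglyMeasurable_const).indicator measurableSet_Icc, α, β, ho,
      Filter.Eventually.of_forall fun x hx => indicator_of_notMem hx _,
      Filter.Eventually.of_forall fun x => ?_, ?_⟩
    · rw [mul_div_cancel_right₀ _ hpos.ne']
      refine (norm_indicator_le_norm_self _ _).trans ((norm_sub_le _ _).trans ?_)
      linarith [hgb x]
    · rw [integral_indicator measurableSet_Icc, hga0]
  have key := hA _ _ hblock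
  have h1 : IntegrableOn (fun x => g x * (η x - c)) I :=
    hIc.bdd_mul (c := 1) hgm.restrict (Filter.Eventually.of_forall hgb)
  -- Both `η - c` and `g - a` have mean zero on `I`, so neither `a` nor `c` contributes and the
  -- pairing is exactly the oscillation.
  have e1 : ∫ x, I.indicator (fun x => g x - a) x * η x
      = ((∫ x in I, ‖η x - c‖ : ℝ) : 𝕜) := by
    have : ∀ x, I.indicator (fun x => g x - a) x * η x = I.indicator (fun x =>
        (g x * (η x - c) - a * (η x - c)) + (g x - a) * c) x := fun x => by
      by_cases hx : x ∈ I
      · simp only [indicator_of_mem hx]; ring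
      · simp only [indicator_of_notMem hx, zero_mul]
    simp only [this]
    have h2 : IntegrableOn (fun x => g x * (η x - c) - a * (η x - c)) I := h1.sub (hIc.const_mul a)
    have h3 : IntegrableOn (fun x => (g x - a) * c) I :=
      (hgi.sub (integrableOn_const hfin)).mul_const c
    rw [integral_indicator measurableSet_Icc, integral_add h2 h3,
      integral_mul_const, hga0, integral_sub h1 (hIc.const_mul a), integral_const_mul, hc0]
    simp only [hgmul, integral_ofReal]
    ring
  rw [e1, RCLike.norm_ofReal] at key
  calc ∫ x in I, ‖η x - c‖ ≤ |∫ x in I, ‖η x - c‖| := le_abs_self _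
    _ ≤ A * (2 * (β - α)) := key
    _ = 2 * A * (β - α) := by ring

theorem bmoENorm_le_of_blocks {η : ℝ → 𝕜} (hη : LocallyIntegrable η) {A : ℝ} (hA0 : 0 ≤ A)
    (hA : ∀ b s, IsBlock b s → ‖∫ x, b x * η x‖ ≤ A * s) :
    bmoENorm η ≤ ENNReal.ofReal (2 * A) := by
  refine iSup₂_le fun α β => iSup_le fun ho => ?_
  have hpos : 0 < β - α := sub_pos.2 ho.1
  have hint : IntegrableOn (fun x => η x - ⨍ y in Icc α β, η y) (Icc α β) :=
    (hη.integrableOn_isCompact isCompact_Icc).sub (integrableOn_const (by simp))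
  rw [← ofReal_integral_norm_eq_lintegral_enorm hint, mul_comm, ← div_eq_mul_inv]
  refine ENNReal.div_le_of_le_mul ?_
  rw [← ENNReal.ofReal_mul (by positivity)]
  exact ENNReal.ofReal_le_ofReal (setIntegral_oscillation_le_of_blocks hη hA ho)

/-! ### Representation and uniqueness modulo two constants -/

/-- The restriction of a bounded compactly supported function in the Hardy space to one side of the
origin is a block. -/
theorem H1.BoundedCompactSupport.isBlock {f : H1 𝕜} (hf : f.BoundedCompactSupport) :
    (∃ s, IsBlock ((Iio 0).indicator f.toL1) s) ∧ ∃ s, IsBlock ((Ici 0).indicator f.toL1) s := by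
  obtain ⟨M, R, h1, h2⟩ := hf
  -- The maximum with `1` keeps the supporting interval nondegenerate.
  set R' : ℝ := max R 1
  have hR' : 0 < R' := lt_max_of_lt_right one_pos
  have hR : R ≤ R' := le_max_left _ _
  have hbd : ∀ S : Set ℝ, ∀ᵐ x, ‖S.indicator f.toL1 x‖ ≤ M * R' / R' := fun S => by
    filter_upwards [h1] with x hx
    rw [mul_div_cancel_right₀ _ hR'.ne']
    exact (norm_indicator_le_norm_self _ _).trans hx
  constructor
  · refine ⟨M * R', f.integrable.1.indicator measurableSet_Iio, -R', 0,
      ⟨by linarith, Or.inl le_rfl⟩, ?_, by simpa using hbd (Iio 0), ?_⟩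
    · filter_upwards [h2] with x hx hx'
      by_cases h0 : x ∈ Iio (0 : ℝ)
      · rw [indicator_of_mem h0]
        refine hx ?_
        have h0' : x < 0 := h0
        have : ¬ (-R' ≤ x) := fun h => hx' ⟨h, h0'.le⟩
        rw [abs_of_neg h0']
        linarith
      · exact indicator_of_notMem h0 _
    · rw [integral_indicator measurableSet_Iio, f.setIntegral_eq_zero.1]
  · refine ⟨M * R', f.integrable.1.indicator measurableSet_Ici, 0, R',
      ⟨hR', Or.inr le_rfl⟩, ?_, by simpa using hbd (Ici 0), ?_⟩
    · filter_upwards [h2] with x hx hx'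
      by_cases h0 : x ∈ Ici (0 : ℝ)
      · rw [indicator_of_mem h0]
        refine hx ?_
        have h0' : 0 ≤ x := h0
        have : ¬ (x ≤ R') := fun h => hx' ⟨h0', h⟩
        rw [abs_of_nonneg h0']
        linarith
      · exact indicator_of_notMem h0 _
    · rw [integral_indicator measurableSet_Ici, f.setIntegral_eq_zero.2]

/-- Cutting `f` at the origin gives two blocks, so no infinite atomic series is needed. -/
theorem represents_of_blocks {φ : ℝ → 𝕜} (hφ : LocallyIntegrable φ) {L : H1 𝕜 →L[𝕜] 𝕜}
    (h : ∀ (b : ℝ → 𝕜) (s : ℝ) (f : H1 𝕜), IsBlock b s → f.toL1 =ᵐ[volume] b →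
      L f = ∫ x, b x * φ x) : Represents φ L := by
  intro f hf
  have hi := hf.integrable_mul hφ
  refine ⟨hi, ?_⟩
  obtain ⟨⟨s, hs⟩, s', hs'⟩ := hf.isBlock
  obtain ⟨f₁, hf₁, -⟩ := hs.exists_h1
  obtain ⟨f₂, hf₂, -⟩ := hs'.exists_h1
  have e : f = f₁ + f₂ := by
    refine H1.ext_ae ?_
    filter_upwards [H1.coeFn_add f₁ f₂, hf₁, hf₂] with x h1 h2 h3
    rw [h1, h2, h3, ← compl_Iio, indicator_self_add_compl_apply]
  have e' : ∀ S : Set ℝ, MeasurableSet S →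
      ∫ x, S.indicator f.toL1 x * φ x = ∫ x in S, f.toL1 x * φ x := fun S hS => by
    rw [← integral_indicator hS]
    simp only [indicator_mul_left]
  conv_lhs => rw [e]
  rw [map_add, h _ _ _ hs hf₁, h _ _ _ hs' hf₂, e' _ measurableSet_Iio, e' _ measurableSet_Ici,
    ← compl_Iio, integral_add_compl measurableSet_Iio hi]

theorem Represents.apply_isBlock {φ : ℝ → 𝕜} {L : H1 𝕜 →L[𝕜] 𝕜} (h : Represents φ L)
    {b : ℝ → 𝕜} {s : ℝ} {f : H1 𝕜} (hb : IsBlock b s) (hf : f.toL1 =ᵐ[volume] b) :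
    Integrable (fun x => b x * φ x) ∧ L f = ∫ x, b x * φ x := by
  obtain ⟨h1, h2⟩ := h f (H1.boundedCompactSupport_of_isBlock hb hf)
  have : (fun x => f.toL1 x * φ x) =ᵐ[volume] fun x => b x * φ x := by
    filter_upwards [hf] with x hx
    rw [hx]
  exact ⟨h1.congr this, h2.trans (integral_congr_ae this)⟩

/-- The constants agree because all the sets contain `I 0`, which is not null. -/
theorem exists_ae_eq_const_iUnion {η : ℝ → 𝕜} {I : ℕ → Set ℝ} (h0 : volume (I 0) ≠ 0)
    (hI : ∀ n, I 0 ⊆ I n) (h : ∀ n, ∃ e, ∀ᵐ x, x ∈ I n → η x = e) :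
    ∃ e, ∀ᵐ x, x ∈ ⋃ n, I n → η x = e := by
  choose e he using h
  have hee : ∀ n, e n = e 0 := by
    intro n
    by_contra hne
    refine h0 (measure_mono_null ?_ (ae_iff.1 ((he n).and (he 0))))
    intro x hx hc
    exact hne ((hc.1 (hI n hx)).symm.trans (hc.2 hx))
  refine ⟨e 0, ?_⟩
  filter_upwards [ae_all_iff.2 he] with x hx hxI
  obtain ⟨n, hn⟩ := mem_iUnion.1 hxI
  rw [hx n hn, hee n]

/-- A function that annihilates all blocks is constant on each side of the origin. -/
theorem exists_consts_of_blocks {η : ℝ → 𝕜} (hη : LocallyIntegrable η)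
    (h : ∀ b s, IsBlock b s → ∫ x, b x * η x = 0) :
    ∃ d e : 𝕜, ∀ᵐ x : ℝ, η x = if x < 0 then d else e := by
  have hosc : ∀ α β, OneSided α β → ∃ e, ∀ᵐ x, x ∈ Icc α β → η x = e := by
    intro α β ho
    refine ⟨⨍ y in Icc α β, η y, ?_⟩
    have h1 := setIntegral_oscillation_le_of_blocks hη (A := 0)
      (fun b s hb => by rw [h b s hb]; simp) ho
    have hint : IntegrableOn (fun x => η x - ⨍ y in Icc α β, η y) (Icc α β) :=
      (hη.integrableOn_isCompact isCompact_Icc).sub (integrableOn_const (by simp))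
    have h2 : ∫ x in Icc α β, ‖η x - ⨍ y in Icc α β, η y‖ = 0 :=
      le_antisymm (by simpa using h1) (integral_nonneg fun _ => norm_nonneg _)
    rw [integral_eq_zero_iff_of_nonneg (fun _ => norm_nonneg _) hint.norm] at h2
    rw [← ae_restrict_iff' measurableSet_Icc]
    filter_upwards [h2] with x hx
    exact sub_eq_zero.1 (norm_eq_zero.1 hx)
  obtain ⟨d, hd⟩ := exists_ae_eq_const_iUnion (η := η)
    (I := fun n : ℕ => Icc (-((n : ℝ) + 1)) 0) (by simp)
    (fun n => Icc_subset_Icc (by simp) le_rfl)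
    (fun n => hosc _ _ ⟨by linarith [n.cast_nonneg (α := ℝ)], Or.inl le_rfl⟩)
  obtain ⟨e, he⟩ := exists_ae_eq_const_iUnion (η := η)
    (I := fun n : ℕ => Icc 0 ((n : ℝ) + 1)) (by simp)
    (fun n => Icc_subset_Icc le_rfl (by simp))
    (fun n => hosc _ _ ⟨by linarith [n.cast_nonneg (α := ℝ)], Or.inr le_rfl⟩)
  refine ⟨d, e, ?_⟩
  filter_upwards [hd, he] with x h1 h2
  obtain ⟨n, hn⟩ := exists_nat_ge |x|
  have hn' := abs_le.1 hn
  split_ifs with hx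
  · exact h1 (mem_iUnion.2 ⟨n, by linarith, hx.le⟩)
  · exact h2 (mem_iUnion.2 ⟨n, not_lt.1 hx, by linarith⟩)

/-- If both represent `L`, then `φ - ψ` annihilates every block. Conversely, constants on each side
are invisible because `f` has integral zero there. -/
theorem represents_iff_eqModConsts {φ ψ : ℝ → 𝕜} {L : H1 𝕜 →L[𝕜] 𝕜}
    (hφ : LocallyIntegrable φ) (hψ : LocallyIntegrable ψ) (h : Represents φ L) :
    Represents ψ L ↔ EqModConsts φ ψ := by
  constructor
  · intro h'
    refine exists_consts_of_blocks (η := fun x => φ x - ψ x) (hφ.sub hψ) fun b s hb => ?_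
    obtain ⟨f, hf, -⟩ := hb.exists_h1
    obtain ⟨h1, h2⟩ := h.apply_isBlock hb hf
    obtain ⟨h1', h2'⟩ := h'.apply_isBlock hb hf
    simp only [mul_sub]
    rw [integral_sub h1 h1', ← h2, ← h2', sub_self]
  · rintro ⟨d, e, hde⟩ f hf
    have hi := hf.integrable_mul hψ
    obtain ⟨h1, h2⟩ := h f hf
    refine ⟨hi, ?_⟩
    have hsub : Integrable (fun x => f.toL1 x * φ x - f.toL1 x * ψ x) := h1.sub hi
    rw [h2, ← sub_eq_zero, ← integral_sub h1 hi, ← integral_add_compl measurableSet_Iio hsub,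
      compl_Iio]
    have e1 : ∫ x in Iio 0, (f.toL1 x * φ x - f.toL1 x * ψ x) = ∫ x in Iio 0, f.toL1 x * d := by
      refine setIntegral_congr_ae measurableSet_Iio ?_
      filter_upwards [hde] with x hx hx0
      rw [← mul_sub, hx, if_pos (mem_Iio.1 hx0)]
    have e2 : ∫ x in Ici 0, (f.toL1 x * φ x - f.toL1 x * ψ x) = ∫ x in Ici 0, f.toL1 x * e := by
      refine setIntegral_congr_ae measurableSet_Ici ?_
      filter_upwards [hde] with x hx hx0
      rw [← mul_sub, hx, if_neg (not_lt.2 (mem_Ici.1 hx0))]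
    rw [e1, e2, integral_mul_const, integral_mul_const, f.setIntegral_eq_zero.1,
      f.setIntegral_eq_zero.2, zero_mul, zero_mul, add_zero]

/-- Every bounded functional on the Hardy space is represented by a function of bounded mean
oscillation. -/
theorem exists_memBMO_represents (L : H1 𝕜 →L[𝕜] 𝕜) :
    ∃ φ : ℝ → 𝕜, MemBMO φ ∧ bmoNorm φ ≤ 2 * ‖L‖ ∧ Represents φ L := by
  obtain ⟨φ, hφ, h⟩ := exists_locallyIntegrable_density L
  have hle : bmoENorm φ ≤ ENNReal.ofReal (2 * ‖L‖) := by
    refine bmoENorm_le_of_blocks hφ (norm_nonneg L) fun b s hb => ?_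
    obtain ⟨f, hf, hfn⟩ := hb.exists_h1
    rw [← h b s f hb hf]
    exact (L.le_opNorm f).trans (by gcongr)
  exact ⟨φ, ⟨hφ, hle.trans_lt ENNReal.ofReal_lt_top⟩,
    ENNReal.toReal_le_of_le_ofReal (by positivity) hle, represents_of_blocks hφ h⟩

end TwoSided

theorem theorem2p2 (𝕜 : Type*) [RCLike 𝕜] :
    ∃ c : ℝ, 0 < c ∧
      (∀ φ : ℝ → 𝕜, TwoSided.MemBMO φ →
        ∃ L : TwoSided.H1 𝕜 →L[𝕜] 𝕜, TwoSided.Represents φ L ∧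
          ‖L‖ ≤ c * TwoSided.bmoNorm φ ∧
          ∀ L' : TwoSided.H1 𝕜 →L[𝕜] 𝕜, TwoSided.Represents φ L' → L' = L) ∧
      (∀ L : TwoSided.H1 𝕜 →L[𝕜] 𝕜,
        ∃ φ : ℝ → 𝕜, TwoSided.MemBMO φ ∧
          c⁻¹ * ‖L‖ ≤ TwoSided.bmoNorm φ ∧ TwoSided.bmoNorm φ ≤ c * ‖L‖ ∧
          TwoSided.Represents φ L ∧
          ∀ ψ : ℝ → 𝕜, TwoSided.MemBMO ψ →
            (TwoSided.Represents ψ L ↔ TwoSided.EqModConsts φ ψ)) := by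
  refine ⟨2, two_pos, fun φ hφ => ?_, fun L => ?_⟩
  · obtain ⟨L, hL, hle⟩ := TwoSided.exists_represents hφ
    exact ⟨L, hL, hle, fun L' hL' => hL.unique hL'⟩
  · obtain ⟨φ, hφ, hle, hL⟩ := TwoSided.exists_memBMO_represents L
    refine ⟨φ, hφ, ?_, hle, hL, fun ψ hψ =>
      TwoSided.represents_iff_eqModConsts hφ.1 hψ.1 hL⟩
    -- The lower bound on the oscillation is the first part applied to `φ`: by uniqueness its
    -- functional is `L`.
    obtain ⟨L', hL', hle'⟩ := TwoSided.exists_represents hφ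
    rw [← hL'.unique hL] at hle'
    rwa [inv_mul_le_iff₀ two_pos]
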